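/- Let $n\ge 2$, let $\mathbb S^n\subset\mathbb R^{n+1}$ be the unit sphere with surface measure $dz$ and area $\omega_n=|\mathbb S^n|$. For $x,\xi,z\in\mathbb S^n$ with $\xi\perp x$ and $z\neq x$ put $$\omega(x,z)=-\int_0^\infty\frac{r^{n-1}}{|x-rz|^{n+1}}\,dr,\qquad \hat\omega(x,\xi,z)=\frac1{\omega_n}\int_0^\infty\frac{|x-rz|^2-(n+1)\langle\xi,rz\rangle^2}{|x-rz|^{n+3}}\,r^{n-1}\,dr .$$ These integrals converge absolutely, and $\omega(x,z)=O(|x-z|^{-n})$ and $\hat\omega(x,\xi,z)=O(|x-z|^{-n})$ for $z$ near $x$, with constants that depend only on $n$. Let $f:\mathbb S^n\to(0,\infty)$, and extend $f$ to $\mathbb R^{n+1}\setminus\{0\}$ as a function homogeneous of degree $-1$. A $C^2$ solution $u:\mathbb S^n\to\mathbb R$ of $\Delta_{\mathbb S^n}u+nu=f$ is called convex if the matrix $\nabla^2u+uI$ is positive semidefinite at every point of $\mathbb S^n$, where $\nabla$ is the covariant derivative of $\mathbb S^n$. (i) If $f$ is Lipschitz continuous, then the extension of $f$ is differentiable at almost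 every $z\in\mathbb S^n$, with Euclidean gradient $Df(z)$, the integral below converges absolutely, and every $C^2$ solution $u$ of $\Delta_{\mathbb S^n}u+nu=f$ is convex if and only if $$\int_{\mathbb S^n}\omega(x,z)\,\langle\xi,z\rangle\,\langle Df(z),\xi\rangle\,dz\ \ge 0\qquad\text{for all }x,\xi\in\mathbb S^n\text{ with }\xi\perp x .$$ (ii) If $f\in C^\alpha(\mathbb S^n)$ for some $\alpha\in(0,1)$, then the integral below converges absolutely, and every $C^2$ solution $u$ of $\Delta_{\mathbb S^n}u+nu=f$ is convex if and only if $$\int_{\mathbb S^n}\hat\omega(x,\xi,z)\,\bigl(f(z)-f(x)\bigr)\,dz+\frac1n f(x)\ \ge 0\qquad\text{for all }x,\xi\in\mathbb S^n\text{ with }\xi\perp x .$$ -/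

import Mathlib

open MeasureTheory Set

open scoped RealInnerProductSpace

noncomputable section

namespace Christoffel

/-- The ambient Euclidean space `ℝ^{n+1}`. -/
abbrev E (n : ℕ) : Type := EuclideanSpace ℝ (Fin (n + 1))

/-- The unit sphere `S^n` in `ℝ^{n+1}`. -/
abbrev S (n : ℕ) : Type := Metric.sphere (0 : E n) 1

/-- The surface measure of `S^n`. -/
def surf (n : ℕ) : Measure (S n) := (volume : Measure (E n)).toSphere

/-- The area `ω_n = |S^n|`. -/
def area (n : ℕ) : ℝ := (surf n).real univ

theorem normalize_mem {n : ℕ} {y : E n} (hy : y ≠ 0) :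
    ‖y‖⁻¹ • y ∈ Metric.sphere (0 : E n) 1 := by
  have h : ‖y‖ ≠ 0 := norm_ne_zero_iff.mpr hy
  simp [norm_smul, h]

open Classical in
/-- The extension of a function on `S^n` to `ℝ^{n+1} \ {0}` which is homogeneous of degree `k`
(with the irrelevant value `0` at the origin). -/
def homExt {n : ℕ} (k : ℤ) (f : S n → ℝ) (y : E n) : ℝ :=
  if hy : y = 0 then 0 else ‖y‖ ^ k * f ⟨‖y‖⁻¹ • y, normalize_mem hy⟩

/-- `u` is of class `C^2` on `S^n`. -/
def IsC2 {n : ℕ} (u : S n → ℝ) : Prop :=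
  ContDiffOn ℝ 2 (homExt 0 u) {0}ᶜ

/-- The Laplacian `Δ_{S^n} u` of the round sphere: the Euclidean Laplacian, at points of the
sphere, of the extension of `u` that is constant along rays. -/
def sphLaplacian {n : ℕ} (u : S n → ℝ) (x : S n) : ℝ :=
  Laplacian.laplacian (homExt 0 u) (x : E n)

/-- The covariant Hessian `∇²u(ξ, η)` of the round sphere at `x`, for `ξ, η` tangent at `x`. The
extension constant along rays has no radial derivative, and so its Euclidean Hessian restricts on
tangent vectors to the covariant one. -/
def sphHessian {n : ℕ} (u : S n → ℝ) (x : S n) (ξ η : E n) : ℝ :=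
  iteratedFDeriv ℝ 2 (homExt 0 u) (x : E n) ![ξ, η]

/-- `u` is a (classical) solution of `Δ_{S^n} u + n u = f` on `S^n`. -/
def IsSolution {n : ℕ} (f u : S n → ℝ) : Prop :=
  IsC2 u ∧ ∀ x : S n, sphLaplacian u x + n * u x = f x

/-- `u` is convex: the matrix `∇²u + u I` is positive semidefinite on each tangent space
of the sphere. -/
def IsConvex {n : ℕ} (u : S n → ℝ) : Prop :=
  ∀ (x : S n) (ξ : E n), ⟪(x : E n), ξ⟫ = 0 → 0 ≤ sphHessian u x ξ ξ + u x * ‖ξ‖ ^ 2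

/-- The integrand of `ω(x, z)`, up to sign. -/
def omegaIntegrand {n : ℕ} (x z : S n) (r : ℝ) : ℝ :=
  r ^ (n - 1) / ‖(x : E n) - r • (z : E n)‖ ^ (n + 1)

/-- The kernel `ω(x, z) = - ∫_0^∞ r^{n-1} / |x - r z|^{n+1} dr`. -/
def omega {n : ℕ} (x z : S n) : ℝ :=
  -∫ r in Ioi (0 : ℝ), omegaIntegrand x z r

/-- The integrand of `ω̂(x, ξ, z)`, up to the factor `1 / ω_n`. -/
def omegaHatIntegrand {n : ℕ} (x ξ z : S n) (r : ℝ) : ℝ :=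
  (‖(x : E n) - r • (z : E n)‖ ^ 2 - (n + 1) * ⟪(ξ : E n), r • (z : E n)⟫ ^ 2) /
    ‖(x : E n) - r • (z : E n)‖ ^ (n + 3) * r ^ (n - 1)

/-- The kernel
`ω̂(x, ξ, z) = 1/ω_n ∫_0^∞ (|x - r z|^2 - (n+1) ⟨ξ, r z⟩^2) / |x - r z|^{n+3} r^{n-1} dr`. -/
def omegaHat {n : ℕ} (x ξ z : S n) : ℝ :=
  1 / area n * ∫ r in Ioi (0 : ℝ), omegaHatIntegrand x ξ z r

/-- The integrand `ω(x, z) ⟨ξ, z⟩ ⟨Df(z), ξ⟩`, where `Df` is the Euclidean derivative of the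
extension of `f` that is homogeneous of degree `-1`. -/
def lipIntegrand {n : ℕ} (f : S n → ℝ) (x ξ z : S n) : ℝ :=
  omega x z * ⟪(ξ : E n), (z : E n)⟫ * fderiv ℝ (homExt (-1) f) (z : E n) (ξ : E n)

end Christoffel

end

namespace Christoffel
open Filter Topology

/-! Let U = `homExt 1 u` and F = `homExt (-1) f`. At a point x of the sphere the Euclidean Hessian
of U on tangent vectors is ∇²u + uI (`sphHessian_add_eq`), and the equation for u becomes ΔU = F
away from the origin (`sum_hess_homExt_one`). So convexity is the sign of D²U(x)(ξ, ξ) for unit ξ ⊥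
x, and the theorem reduces to an integral formula for this number.

Formally D²U(x)(ξ, ξ) is the integral of ∂_ξ∂_ξ Φ(y - x) F(y), with Φ the fundamental solution of
the Laplacian on ℝ^{n+1}. To prove it, |y| is replaced in the derivatives of Φ by √(|y|² + ε²). Two
integrations by parts against U, with the third derivative always on the smooth kernel, exchange the
pairs of derivatives on kernel and on U (`integral_hessKer_mul_hess_swap`); summing over a basis
turns ΔΦ_ε paired with ∂_ξ∂_ξ U into ∂_ξ∂_ξ Φ_ε paired with ΔU = F (`integral_approx_mul_hess`). As
ε → 0, ω_n ΔΦ_ε is an approximate identity of mass ω_n (`tendsto_integral_approx`), so the left side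
recovers the Hessian.

The right side needs a kernel that is still integrable at x when ε = 0. For Lipschitz f, one more
integration by parts leaves ∂_ξ Φ ∂_ξ F, of size |y - x|^{-n} |y|^{-2} (`hess_eq_integral_gradKer`).
For Hölder f, subtracting the constant f(x)/n from u replaces f by f - f(x) and gains a factor |y -
x|^α (`hess_eq_integral_hessKer`); the subtracted constant returns as the term f(x)/n.

Finally polar coordinates y = rz are used. By homogeneity the data leave the radial integral, and
what remains of the kernel is ω or ω̂ (`polar_gradKer`, `polar_hessKer`). -/

instance (n : ℕ) : IsFiniteMeasure (surf n) :=
  inferInstanceAs (IsFiniteMeasure (volume : Measure (E n)).toSphere)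

theorem finrank_E (n : ℕ) : Module.finrank ℝ (E n) = n + 1 := by simp

/-! ### Integrability of powers of the distances to one and to two points. -/

theorem integrable_norm_rpow_mul {n : ℕ} {a b : ℝ} (_hb : 0 ≤ b) (ha : a < n + 1)
    (hab : (n : ℝ) + 1 < a + b) :
    Integrable (fun y : E n => ‖y‖ ^ (-a) * (1 + ‖y‖) ^ (-b)) := by
  rw [integrable_fun_norm_addHaar (μ := (volume : Measure (E n)))
    (f := fun r => r ^ (-a) * (1 + r) ^ (-b)), finrank_E, Nat.add_sub_cancel,
    ← Ioc_union_Ioi_eq_Ioi zero_le_one]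
  have hm : Measurable (fun r : ℝ => r ^ n • (r ^ (-a) * (1 + r) ^ (-b))) := by fun_prop
  refine IntegrableOn.union ?_ ?_
  · have h1 : IntegrableOn (fun r : ℝ => r ^ ((n : ℝ) - a)) (Ioc 0 1) :=
      (intervalIntegrable_iff_integrableOn_Ioc_of_le zero_le_one).1
        (intervalIntegral.intervalIntegrable_rpow' (by linarith))
    refine h1.mono' hm.aestronglyMeasurable ?_
    filter_upwards [ae_restrict_mem measurableSet_Ioc] with r hr
    have h0 : 0 < r := hr.1
    rw [Real.norm_of_nonneg (by positivity), smul_eq_mul, ← mul_assoc, ← Real.rpow_natCast,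
      ← Real.rpow_add h0, ← sub_eq_add_neg]
    exact mul_le_of_le_one_right (by positivity)
      (Real.rpow_le_one_of_one_le_of_nonpos (by linarith) (by linarith))
  · have h1 : IntegrableOn (fun r : ℝ => r ^ ((n : ℝ) - a - b)) (Ioi 1) :=
      integrableOn_Ioi_rpow_of_lt (by linarith) zero_lt_one
    refine h1.mono' hm.aestronglyMeasurable ?_
    filter_upwards [ae_restrict_mem measurableSet_Ioi] with r hr
    have h0 : 0 < r := zero_lt_one.trans hr
    rw [Real.norm_of_nonneg (by positivity), smul_eq_mul, ← mul_assoc, ← Real.rpow_natCast,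
      ← Real.rpow_add h0, ← sub_eq_add_neg, sub_eq_add_neg _ b, Real.rpow_add h0]
    gcongr ?_ * ?_
    exact Real.rpow_le_rpow_of_nonpos h0 (by linarith) (by linarith)

theorem integrable_inv_norm_pow_mul {n : ℕ} {a b : ℕ} (ha : a < n + 1) (hab : n + 1 < a + b) :
    Integrable (fun y : E n => (‖y‖ ^ a)⁻¹ * ((1 + ‖y‖) ^ b)⁻¹) := by
  have := integrable_norm_rpow_mul (n := n) (a := a) (b := b) (by positivity)
    (by exact_mod_cast ha) (by exact_mod_cast hab)
  refine this.congr (.of_forall fun y => ?_)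
  simp only [Real.rpow_neg (norm_nonneg y), Real.rpow_neg (by positivity : 0 ≤ 1 + ‖y‖),
    Real.rpow_natCast]

/-- The two poles are at distance 1. Where |y - x| ≥ 1/2 that factor is comparable to a power of 1 +
|y|; otherwise |y| ≥ 1/2 and the other factor is comparable to a power of 1 + |y - x|. The sum of
the two one-pole functions dominates. -/
theorem integrable_norm_rpow_mul_sub {n : ℕ} (x : S n) {a b : ℝ} (ha0 : 0 ≤ a) (hb0 : 0 ≤ b)
    (ha : a < n + 1) (hb : b < n + 1) (hab : (n : ℝ) + 1 < a + b) :
    Integrable (fun y : E n => ‖y‖ ^ (-a) * ‖y - x‖ ^ (-b)) := by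
  have hx : ‖(x : E n)‖ = 1 := by simp
  have h1 := (integrable_norm_rpow_mul (n := n) hb0 ha hab).const_mul ((5 : ℝ) ^ b)
  have h2 := ((integrable_norm_rpow_mul (n := n) ha0 hb (by linarith)).comp_sub_right
    (x : E n)).const_mul ((5 : ℝ) ^ a)
  refine (h1.add h2).mono' (by fun_prop) ?_
  -- The 5 comes from 1 + s ≤ 2 + t ≤ 5t when t ≥ 1/2.
  have key : ∀ (s t c : ℝ), 0 ≤ c → 0 ≤ s → 1 / 2 ≤ t → s ≤ 1 + t →
      t ^ (-c) ≤ 5 ^ c * (1 + s) ^ (-c) := by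
    intro s t c hc hs ht hst
    have : (5 : ℝ) ^ c * (1 + s) ^ (-c) = ((1 + s) / 5) ^ (-c) := by
      rw [Real.div_rpow (by positivity) (by norm_num), Real.rpow_neg (by norm_num : (0:ℝ) ≤ 5)]
      field_simp
    rw [this]
    exact Real.rpow_le_rpow_of_nonpos (by positivity) (by linarith) (by linarith)
  refine .of_forall fun y => ?_
  rw [Real.norm_of_nonneg (by positivity)]
  simp only [Pi.add_apply]
  have t1 : ‖y‖ ≤ 1 + ‖y - x‖ := by
    have := norm_add_le (x : E n) (y - x); simpa [hx] using this
  have t2 : ‖y - x‖ ≤ 1 + ‖y‖ := by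
    have := norm_sub_le y (x : E n); rw [hx] at this; linarith
  have t3 : 1 ≤ ‖y‖ + ‖y - x‖ := by
    have := norm_sub_le y (y - x); simpa [hx] using this
  rcases le_total (1 / 2) ‖y - x‖ with h | h
  · have := key ‖y‖ ‖y - x‖ b hb0 (norm_nonneg _) h t1
    have h' : 0 ≤ (5:ℝ) ^ a * (‖y - x‖ ^ (-b) * (1 + ‖y - x‖) ^ (-a)) := by positivity
    have h'' := mul_le_mul_of_nonneg_left this (by positivity : 0 ≤ ‖y‖ ^ (-a))
    linarith
  · have := key ‖y - x‖ ‖y‖ a ha0 (norm_nonneg _) (by linarith) t2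
    have h' : 0 ≤ (5:ℝ) ^ b * (‖y‖ ^ (-a) * (1 + ‖y‖) ^ (-b)) := by positivity
    have h'' := mul_le_mul_of_nonneg_right this (by positivity : 0 ≤ ‖y - x‖ ^ (-b))
    linarith

/-! ### Polar coordinates. -/

theorem polar_ae_prod {n : ℕ} {p : E n → Prop} (hp : ∀ᵐ y, p y) :
    ∀ᵐ q : S n × Ioi (0 : ℝ) ∂((surf n).prod (.volumeIoiPow n)), p ((q.2 : ℝ) • (q.1 : E n)) := by
  have mp := (volume : Measure (E n)).measurePreserving_homeomorphUnitSphereProd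
  rw [finrank_E, Nat.add_sub_cancel] at mp
  rw [surf, ← mp.map_eq, (Homeomorph.measurableEmbedding _).ae_map_iff]
  have : ∀ᵐ y : ({0}ᶜ : Set (E n)) ∂((volume : Measure (E n)).comap Subtype.val), p y := by
    rw [← (MeasurableEmbedding.subtype_coe (measurableSet_singleton _).compl).ae_map_iff
      (p := p), map_comap_subtype_coe (measurableSet_singleton _).compl]
    exact ae_restrict_of_ae hp
  filter_upwards [this] with y hy
  have h0 : ‖(y : E n)‖ ≠ 0 := norm_ne_zero_iff.2 y.2
  simpa [smul_smul, h0] using hy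

/-- The sphere is a null set, so an almost-everywhere statement in space says nothing about it
directly. Fubini gives, for almost every direction z, some good radius r, and `hom` carries the
property from rz back to z. -/
theorem polar_ae {n : ℕ} {p : E n → Prop} (hp : ∀ᵐ y, p y)
    (hom : ∀ (z : S n) (r : ℝ), 0 < r → p (r • (z : E n)) → p z) :
    ∀ᵐ z : S n ∂(surf n), p z := by
  have h := Measure.ae_ae_of_ae_prod (polar_ae_prod hp)
  filter_upwards [h] with z hz
  -- The interval (0, 1) has mass 1/(n + 1), so the radial measure is not zero and a good radius
  -- exists.
  have : NeZero (Measure.volumeIoiPow n) := ⟨fun h0 => by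
    have := Measure.volumeIoiPow_apply_Iio n ⟨1, by simp⟩
    rw [h0] at this
    simp at this
    have h3 : (0 : ℝ) < ((n : ℝ) + 1)⁻¹ := by positivity
    linarith⟩
  obtain ⟨r, hr⟩ := hz.exists
  exact hom z r r.2 hr

theorem integral_volumeIoiPow (n : ℕ) (g : ℝ → ℝ) :
    ∫ r : Ioi (0 : ℝ), g r ∂(.volumeIoiPow n) = ∫ r in Ioi (0 : ℝ), r ^ n * g r := by
  simp only [Measure.volumeIoiPow, ENNReal.ofReal]
  rw [integral_withDensity_eq_integral_smul,
    integral_subtype_comap measurableSet_Ioi fun a ↦ Real.toNNReal (a ^ n) • g a,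
    setIntegral_congr_fun measurableSet_Ioi fun x hx ↦ ?_]
  · rw [NNReal.smul_def, Real.coe_toNNReal _ (pow_nonneg hx.out.le _), smul_eq_mul]
  · exact (measurable_subtype_coe.pow_const _).real_toNNReal

/-- The integrability half is the source of the absolute convergence of both integrals over the
sphere. -/
theorem polar_integral {n : ℕ} {g : E n → ℝ} (hg : Integrable g) :
    Integrable (fun z : S n => ∫ r in Ioi (0 : ℝ), r ^ n * g (r • (z : E n))) (surf n) ∧
      ∫ y, g y = ∫ z : S n, (∫ r in Ioi (0 : ℝ), r ^ n * g (r • (z : E n))) ∂(surf n) := by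
  have mp := (volume : Measure (E n)).measurePreserving_homeomorphUnitSphereProd
  rw [finrank_E, Nat.add_sub_cancel] at mp
  have em := (homeomorphUnitSphereProd (E n)).measurableEmbedding
  have hcomp : ∀ y : ({0}ᶜ : Set (E n)),
      g (((homeomorphUnitSphereProd (E n) y).2 : ℝ) •
        ((homeomorphUnitSphereProd (E n) y).1 : E n)) = g y := fun y => by
    have h0 : ‖(y : E n)‖ ≠ 0 := norm_ne_zero_iff.2 y.2
    simp [smul_smul, h0]
  have hi : Integrable (fun q : S n × Ioi (0 : ℝ) => g ((q.2 : ℝ) • (q.1 : E n)))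
      ((surf n).prod (.volumeIoiPow n)) := by
    rw [surf, ← mp.integrable_comp_emb em]
    simp only [Function.comp_def, hcomp]
    exact (integrableOn_iff_comap_subtypeVal (measurableSet_singleton _).compl).1 hg.integrableOn
  have h1 := hi.integral_prod_left
  simp only [fun z : S n => integral_volumeIoiPow n (fun r => g (r • (z : E n)))] at h1
  refine ⟨h1, ?_⟩
  have h2 := integral_prod _ hi
  simp only [fun z : S n => integral_volumeIoiPow n (fun r => g (r • (z : E n)))] at h2
  rw [← h2, surf, ← mp.integral_comp em]
  simp only [hcomp]
  rw [integral_subtype_comap (measurableSet_singleton _).compl g, restrict_compl_singleton]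

/-! ### Derivatives of the regularised fundamental solution. -/

/-- The regularised inverse distance `(|y|² + ε²)^{-1/2}`. -/
noncomputable def invNorm {n : ℕ} (ε : ℝ) (y : E n) : ℝ := (√(‖y‖ ^ 2 + ε ^ 2))⁻¹

/-- The derivative in the direction `v` of the regularised fundamental solution, multiplied by the
area of the sphere. -/
noncomputable def gradKer {n : ℕ} (ε : ℝ) (v y : E n) : ℝ := ⟪y, v⟫ * invNorm ε y ^ (n + 1)

/-- The Hessian of the regularised fundamental solution, multiplied by the area of the sphere. -/
noncomputable def hessKer {n : ℕ} (ε : ℝ) (v w y : E n) : ℝ :=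
  ⟪v, w⟫ * invNorm ε y ^ (n + 1) - (n + 1) * (⟪y, v⟫ * ⟪y, w⟫ * invNorm ε y ^ (n + 3))

/-- The third derivative of the regularised fundamental solution, multiplied by the area of the
sphere. -/
noncomputable def thirdKer {n : ℕ} (ε : ℝ) (v w t y : E n) : ℝ :=
  -((n + 1) * ((⟪v, w⟫ * ⟪y, t⟫ + ⟪v, t⟫ * ⟪y, w⟫ + ⟪w, t⟫ * ⟪y, v⟫) * invNorm ε y ^ (n + 3))) +
    (n + 1) * (n + 3) * (⟪y, v⟫ * ⟪y, w⟫ * ⟪y, t⟫ * invNorm ε y ^ (n + 5))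

variable {n : ℕ} {ε : ℝ}

theorem invNorm_nonneg (y : E n) : 0 ≤ invNorm ε y := by unfold invNorm; positivity

theorem invNorm_zero (y : E n) : invNorm 0 y = ‖y‖⁻¹ := by
  simp [invNorm, Real.sqrt_sq]

theorem invNorm_sq (hε : 0 < ε) (y : E n) : (‖y‖ ^ 2 + ε ^ 2) * invNorm ε y ^ 2 = 1 := by
  unfold invNorm
  rw [inv_pow, Real.sq_sqrt (by positivity)]
  exact mul_inv_cancel₀ (by positivity)

theorem norm_mul_invNorm_le (y : E n) : ‖y‖ * invNorm ε y ≤ 1 := by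
  unfold invNorm
  rw [← div_eq_mul_inv]
  refine div_le_one_of_le₀ (Real.le_sqrt_of_sq_le ?_) (by positivity)
  nlinarith

theorem invNorm_le_inv_norm {y : E n} (hy : y ≠ 0) : invNorm ε y ≤ ‖y‖⁻¹ := by
  have : 0 < ‖y‖ := norm_pos_iff.2 hy
  rw [← one_div, le_div_iff₀ this, mul_comm]
  exact norm_mul_invNorm_le y

/-- For fixed ε the kernel has no pole, so its decay can be measured from the origin, where the
homogeneous data are singular. With S the square root, 1 + |y| ≤ 2 + |y - x| ≤ (2/ε + 1) S. -/
theorem invNorm_sub_le (hε : 0 < ε) {x : E n} (hx : ‖x‖ = 1) (y : E n) :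
    invNorm ε (y - x) ≤ (2 / ε + 1) * (1 + ‖y‖)⁻¹ := by
  unfold invNorm
  rw [← div_eq_mul_inv, inv_eq_one_div, div_le_div_iff₀ (by positivity) (by positivity), one_mul]
  have h1 : ‖y - x‖ ≤ √(‖y - x‖ ^ 2 + ε ^ 2) := Real.le_sqrt_of_sq_le (by nlinarith)
  have h2 : ε ≤ √(‖y - x‖ ^ 2 + ε ^ 2) := Real.le_sqrt_of_sq_le (by nlinarith [sq_nonneg ‖y - x‖])
  have h3 : ‖y‖ ≤ 1 + ‖y - x‖ := by
    have := norm_add_le x (y - x); simpa [hx] using this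
  have h4 : 2 ≤ 2 / ε * √(‖y - x‖ ^ 2 + ε ^ 2) := by
    rw [div_mul_eq_mul_div, le_div_iff₀ hε]; linarith
  linarith

/-- Each inner product in a kernel absorbs one power of `invNorm`. Hence the kernel of order k is
bounded by a multiple of `invNorm ε y ^ (n - 1 + k)`, uniformly in ε, which gives the dominating
functions for ε → 0. -/
theorem abs_inner_mul_invNorm_le (v y : E n) : |⟪y, v⟫| * invNorm ε y ≤ ‖v‖ := by
  calc |⟪y, v⟫| * invNorm ε y ≤ (‖y‖ * ‖v‖) * invNorm ε y :=
        mul_le_mul_of_nonneg_right (abs_real_inner_le_norm _ _) (invNorm_nonneg y)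
    _ = (‖y‖ * invNorm ε y) * ‖v‖ := by ring
    _ ≤ 1 * ‖v‖ := mul_le_mul_of_nonneg_right (norm_mul_invNorm_le y) (norm_nonneg v)
    _ = ‖v‖ := one_mul _

theorem abs_gradKer_le (v y : E n) : |gradKer ε v y| ≤ ‖v‖ * invNorm ε y ^ n := by
  have h0 := invNorm_nonneg (ε := ε) y
  rw [gradKer, abs_mul, abs_of_nonneg (pow_nonneg h0 _), pow_succ', ← mul_assoc]
  exact mul_le_mul_of_nonneg_right (abs_inner_mul_invNorm_le v y) (pow_nonneg h0 _)

theorem abs_hessKer_le (v w y : E n) :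
    |hessKer ε v w y| ≤ (n + 2) * (‖v‖ * ‖w‖) * invNorm ε y ^ (n + 1) := by
  have h0 := invNorm_nonneg (ε := ε) y
  have hp := pow_nonneg h0 (n + 1)
  have h1 : |⟪v, w⟫ * invNorm ε y ^ (n + 1)| ≤ ‖v‖ * ‖w‖ * invNorm ε y ^ (n + 1) := by
    rw [abs_mul, abs_of_nonneg hp]
    exact mul_le_mul_of_nonneg_right (abs_real_inner_le_norm _ _) hp
  have h2 : |⟪y, v⟫ * ⟪y, w⟫ * invNorm ε y ^ (n + 3)| ≤ ‖v‖ * ‖w‖ * invNorm ε y ^ (n + 1) := by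
    rw [show ⟪y, v⟫ * ⟪y, w⟫ * invNorm ε y ^ (n + 3) =
      (⟪y, v⟫ * invNorm ε y) * (⟪y, w⟫ * invNorm ε y) * invNorm ε y ^ (n + 1) by ring]
    simp only [abs_mul, abs_of_nonneg hp, abs_of_nonneg h0]
    gcongr <;> exact abs_inner_mul_invNorm_le _ y
  have hn : (0 : ℝ) ≤ n + 1 := by positivity
  calc _ ≤ _ := abs_sub _ _
    _ = |⟪v, w⟫ * invNorm ε y ^ (n + 1)| + (n + 1) * |⟪y, v⟫ * ⟪y, w⟫ * invNorm ε y ^ (n + 3)| := by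
        rw [abs_mul ((n : ℝ) + 1), abs_of_nonneg hn]
    _ ≤ ‖v‖ * ‖w‖ * invNorm ε y ^ (n + 1) + (n + 1) * (‖v‖ * ‖w‖ * invNorm ε y ^ (n + 1)) := by
        gcongr
    _ = _ := by ring

theorem abs_thirdKer_le (v w t y : E n) :
    |thirdKer ε v w t y| ≤
      ((n + 1) * 3 + (n + 1) * (n + 3)) * (‖v‖ * ‖w‖ * ‖t‖) * invNorm ε y ^ (n + 2) := by
  have h0 := invNorm_nonneg (ε := ε) y
  have hp := pow_nonneg h0 (n + 2)
  set B := ‖v‖ * ‖w‖ * ‖t‖ * invNorm ε y ^ (n + 2) with hB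
  have h1 : ∀ a b c : E n, |⟪a, b⟫ * ⟪y, c⟫ * invNorm ε y ^ (n + 3)| ≤
      ‖a‖ * ‖b‖ * ‖c‖ * invNorm ε y ^ (n + 2) := fun a b c => by
    rw [show ⟪a, b⟫ * ⟪y, c⟫ * invNorm ε y ^ (n + 3) =
      ⟪a, b⟫ * (⟪y, c⟫ * invNorm ε y) * invNorm ε y ^ (n + 2) by ring]
    simp only [abs_mul, abs_of_nonneg hp, abs_of_nonneg h0]
    gcongr
    · exact abs_real_inner_le_norm _ _
    · exact abs_inner_mul_invNorm_le _ y
  have h2 : |⟪y, v⟫ * ⟪y, w⟫ * ⟪y, t⟫ * invNorm ε y ^ (n + 5)| ≤ B := by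
    rw [show ⟪y, v⟫ * ⟪y, w⟫ * ⟪y, t⟫ * invNorm ε y ^ (n + 5) =
      (⟪y, v⟫ * invNorm ε y) * (⟪y, w⟫ * invNorm ε y) * (⟪y, t⟫ * invNorm ε y) *
        invNorm ε y ^ (n + 2) by ring]
    simp only [abs_mul, abs_of_nonneg hp, abs_of_nonneg h0]
    rw [hB]
    gcongr <;> exact abs_inner_mul_invNorm_le _ y
  have e1 := h1 v w t
  have e2 := h1 v t w
  have e3 := h1 w t v
  have h3 : |(⟪v, w⟫ * ⟪y, t⟫ + ⟪v, t⟫ * ⟪y, w⟫ + ⟪w, t⟫ * ⟪y, v⟫) * invNorm ε y ^ (n + 3)| ≤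
      3 * B := by
    rw [abs_le] at e1 e2 e3 ⊢
    constructor <;> linarith
  have hn : (0 : ℝ) ≤ n + 1 := by positivity
  have hn3 : (0 : ℝ) ≤ (n + 1) * (n + 3) := by positivity
  calc _ ≤ _ := abs_add_le _ _
    _ = (n + 1) * |(⟪v, w⟫ * ⟪y, t⟫ + ⟪v, t⟫ * ⟪y, w⟫ + ⟪w, t⟫ * ⟪y, v⟫) * invNorm ε y ^ (n + 3)| +
        (n + 1) * (n + 3) * |⟪y, v⟫ * ⟪y, w⟫ * ⟪y, t⟫ * invNorm ε y ^ (n + 5)| := by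
        rw [abs_neg, abs_mul ((n : ℝ) + 1), abs_mul (((n : ℝ) + 1) * _), abs_of_nonneg hn,
          abs_of_nonneg hn3]
    _ ≤ (n + 1) * (3 * B) + (n + 1) * (n + 3) * B := by gcongr
    _ = _ := by ring

theorem contDiff_invNorm (hε : 0 < ε) : ContDiff ℝ 1 (invNorm ε : E n → ℝ) := by
  unfold invNorm
  have h : ∀ y : E n, ‖y‖ ^ 2 + ε ^ 2 ≠ 0 := fun y => by positivity
  refine ContDiff.inv (ContDiff.sqrt ((contDiff_norm_sq ℝ).add contDiff_const) h) fun y => ?_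
  positivity

theorem contDiff_gradKer (hε : 0 < ε) (v : E n) : ContDiff ℝ 1 (gradKer ε v) := by
  have := contDiff_invNorm (n := n) hε
  exact (contDiff_id.inner ℝ contDiff_const).mul (this.pow _)

theorem contDiff_hessKer (hε : 0 < ε) (v w : E n) : ContDiff ℝ 1 (hessKer ε v w) := by
  have := contDiff_invNorm (n := n) hε
  exact (contDiff_const.mul (this.pow _)).sub (contDiff_const.mul
    (((contDiff_id.inner ℝ contDiff_const).mul (contDiff_id.inner ℝ contDiff_const)).mul
      (this.pow _)))

theorem hasFDerivAt_invNorm_pow (hε : 0 < ε) (k : ℕ) (y : E n) :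
    HasFDerivAt (fun y => invNorm ε y ^ k) (-(k * invNorm ε y ^ (k + 2)) • innerSL ℝ y) y := by
  have h : ‖y‖ ^ 2 + ε ^ 2 ≠ 0 := by positivity
  have h1 : HasFDerivAt (fun y : E n => ‖y‖ ^ 2 + ε ^ 2) (2 • innerSL ℝ y) y :=
    (hasStrictFDerivAt_norm_sq y).hasFDerivAt.add_const _
  have h2 := (hasDerivAt_inv (Real.sqrt_ne_zero'.2 (by positivity))).comp_hasFDerivAt y (h1.sqrt h)
  refine (h2.pow k).congr_fderiv ?_
  ext w
  rcases k with _ | k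
  · simp
  have h0 : √(‖y‖ ^ 2 + ε ^ 2) ≠ 0 := by positivity
  simp [invNorm]
  field_simp
  ring

theorem hasFDerivAt_inner_left (v y : E n) :
    HasFDerivAt (fun y : E n => ⟪y, v⟫) (innerSL ℝ v) y := by
  refine (innerSL ℝ v).hasFDerivAt.congr_of_eventuallyEq (.of_forall fun z => ?_)
  simp [real_inner_comm]

theorem fderiv_gradKer (hε : 0 < ε) (v w y : E n) :
    fderiv ℝ (gradKer ε v) y w = hessKer ε v w y := by
  have h := (hasFDerivAt_inner_left v y).mul (hasFDerivAt_invNorm_pow hε (n + 1) y)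
  rw [show gradKer ε v = (fun y => ⟪y, v⟫) * (fun y => invNorm ε y ^ (n + 1)) from rfl, h.fderiv]
  simp [hessKer]
  ring

theorem fderiv_hessKer (hε : 0 < ε) (v w t y : E n) :
    fderiv ℝ (hessKer ε v w) y t = thirdKer ε v w t y := by
  have h := ((hasFDerivAt_invNorm_pow hε (n + 1) y).const_mul ⟪v, w⟫).sub
    ((((hasFDerivAt_inner_left v y).mul (hasFDerivAt_inner_left w y)).mul
      (hasFDerivAt_invNorm_pow hε (n + 3) y)).const_mul ((n : ℝ) + 1))
  have h' : HasFDerivAt (hessKer ε v w) _ y := h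
  rw [h'.fderiv]
  simp [thirdKer]
  ring

/-- With `thirdKer_swap_left`, the symmetry of third derivatives; it is what allows derivatives to
be exchanged between the kernel and U. -/
theorem thirdKer_swap (v w t y : E n) : thirdKer ε v w t y = thirdKer ε v t w y := by
  unfold thirdKer; rw [real_inner_comm w t]; ring

theorem thirdKer_swap_left (v w t y : E n) : thirdKer ε v w t y = thirdKer ε w v t y := by
  unfold thirdKer; rw [real_inner_comm v w]; ring

/-- The Laplacian of the regularised fundamental solution. -/
theorem sum_hessKer (hε : 0 < ε) (b : OrthonormalBasis (Fin (n + 1)) ℝ (E n)) (y : E n) :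
    ∑ i, hessKer ε (b i) (b i) y = (n + 1) * ε ^ 2 * invNorm ε y ^ (n + 3) := by
  have h1 : ∑ i, ⟪y, b i⟫ * ⟪y, b i⟫ = ‖y‖ ^ 2 := by
    have := b.sum_inner_mul_inner y y
    simpa [real_inner_comm] using this
  simp only [hessKer, Finset.sum_sub_distrib, ← Finset.mul_sum, ← Finset.sum_mul, h1]
  have h2 := invNorm_sq hε y
  simp
  -- The trace is (n + 1) p^{n+1} (1 - |y|² p²) with p the inverse distance, and 1 - |y|² p² = ε²
  -- p².
  linear_combination ((n : ℝ) + 1) * invNorm ε y ^ (n + 1) * (-h2)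

theorem tendsto_invNorm {y : E n} (hy : y ≠ 0) :
    Tendsto (fun ε => invNorm ε y) (𝓝 0) (𝓝 (invNorm 0 y)) := by
  have h : ‖y‖ ≠ 0 := norm_ne_zero_iff.2 hy
  have : ContinuousAt (fun ε => invNorm ε y) 0 := by
    unfold invNorm
    refine ContinuousAt.inv₀ (by fun_prop) ?_
    simpa using h
  exact this

theorem tendsto_gradKer (v : E n) {y : E n} (hy : y ≠ 0) :
    Tendsto (fun ε => gradKer ε v y) (𝓝 0) (𝓝 (gradKer 0 v y)) :=
  ((tendsto_invNorm hy).pow _).const_mul _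

theorem tendsto_hessKer (v w : E n) {y : E n} (hy : y ≠ 0) :
    Tendsto (fun ε => hessKer ε v w y) (𝓝 0) (𝓝 (hessKer 0 v w y)) :=
  (((tendsto_invNorm hy).pow _).const_mul _).sub
    ((((tendsto_invNorm hy).pow _).const_mul _).const_mul _)

@[fun_prop]
theorem measurable_invNorm : Measurable (invNorm ε : E n → ℝ) := by
  unfold invNorm; fun_prop

@[fun_prop]
theorem measurable_gradKer (v : E n) : Measurable (gradKer ε v) := by
  unfold gradKer; fun_prop

@[fun_prop]
theorem measurable_hessKer (v w : E n) : Measurable (hessKer ε v w) := by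
  unfold hessKer; fun_prop

@[fun_prop]
theorem measurable_thirdKer (v w t : E n) : Measurable (thirdKer ε v w t) := by
  unfold thirdKer; fun_prop

/-! ### Cut-offs and integration by parts away from the origin. -/

/-- A smooth bump equal to `1` on the unit ball and supported in the ball of radius `2`. -/
noncomputable def bump (n : ℕ) : ContDiffBump (0 : E n) := ⟨1, 2, one_pos, one_lt_two⟩

/-- A cut-off equal to `1` for `2 / k ≤ |y| ≤ k` and vanishing for `|y| ≤ 1 / k` and
`|y| ≥ 2 k`. -/
noncomputable def cutoff (n : ℕ) (k : ℝ) (y : E n) : ℝ :=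
  bump n (k⁻¹ • y) * (1 - bump n (k • y))

theorem contDiff_cutoff (k : ℝ) : ContDiff ℝ 1 (cutoff n k) := by
  have h : ContDiff ℝ 1 (bump n) := (bump n).contDiff
  exact (h.comp (contDiff_const_smul _)).mul
    (contDiff_const.sub (h.comp (contDiff_const_smul _)))

theorem cutoff_nonneg (k : ℝ) (y : E n) : 0 ≤ cutoff n k y :=
  mul_nonneg (bump n).nonneg (sub_nonneg.2 (bump n).le_one)

theorem cutoff_le_one (k : ℝ) (y : E n) : cutoff n k y ≤ 1 :=
  mul_le_one₀ (bump n).le_one (sub_nonneg.2 (bump n).le_one)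
    (sub_le_self _ (bump n).nonneg)

theorem bump_one {y : E n} (h : ‖y‖ ≤ 1) : bump n y = 1 :=
  (bump n).one_of_mem_closedBall (by simpa [bump] using h)

theorem bump_zero {y : E n} (h : 2 ≤ ‖y‖) : bump n y = 0 :=
  (bump n).zero_of_le_dist (by simpa [bump] using h)

theorem cutoff_eq_zero_of_le {k : ℝ} (hk : 0 < k) {y : E n} (h : ‖y‖ ≤ 1 / k) :
    cutoff n k y = 0 := by
  rw [cutoff, bump_one (y := k • y), sub_self, mul_zero]
  rw [norm_smul, Real.norm_of_nonneg hk.le]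
  rwa [le_div_iff₀ hk, mul_comm] at h

theorem cutoff_eq_zero_of_ge {k : ℝ} (hk : 0 < k) {y : E n} (h : 2 * k ≤ ‖y‖) :
    cutoff n k y = 0 := by
  rw [cutoff, bump_zero (y := k⁻¹ • y), zero_mul]
  rw [norm_smul, Real.norm_of_nonneg (by positivity), inv_mul_eq_div, le_div_iff₀ hk]
  exact h

theorem cutoff_eq_one {k : ℝ} (hk : 0 < k) {y : E n} (h1 : 2 / k ≤ ‖y‖) (h2 : ‖y‖ ≤ k) :
    cutoff n k y = 1 := by
  rw [cutoff, bump_zero (y := k • y), bump_one (y := k⁻¹ • y)]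
  · simp
  · rw [norm_smul, Real.norm_of_nonneg (by positivity), inv_mul_eq_div]
    exact div_le_one_of_le₀ h2 hk.le
  · rw [norm_smul, Real.norm_of_nonneg hk.le, mul_comm]
    rwa [div_le_iff₀ hk] at h1

theorem fderiv_cutoff_eq_zero {k : ℝ} (hk : 0 < k) {y : E n} (h1 : 2 / k < ‖y‖) (h2 : ‖y‖ < k) :
    fderiv ℝ (cutoff n k) y = 0 := by
  have : cutoff n k =ᶠ[𝓝 y] fun _ => 1 := by
    filter_upwards [continuous_norm.continuousAt.eventually (lt_mem_nhds h1),
      continuous_norm.continuousAt.eventually (gt_mem_nhds h2)] with z hz1 hz2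
    exact cutoff_eq_one hk hz1.le hz2.le
  rw [this.fderiv_eq]
  simp

theorem exists_norm_mul_fderiv_bump_le (n : ℕ) :
    ∃ C, 0 ≤ C ∧ ∀ y : E n, ‖y‖ * ‖fderiv ℝ (bump n) y‖ ≤ C := by
  have h : ContDiff ℝ 1 (bump n) := (bump n).contDiff
  have hc : Continuous (fun y : E n => ‖y‖ * ‖fderiv ℝ (bump n) y‖) :=
    continuous_norm.mul (h.continuous_fderiv (by simp)).norm
  have hs : HasCompactSupport (fun y : E n => ‖y‖ * ‖fderiv ℝ (bump n) y‖) :=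
    ((bump n).hasCompactSupport.fderiv ℝ).norm.mul_left
  obtain ⟨C, hC⟩ := hs.exists_bound_of_continuous hc
  exact ⟨C, (norm_nonneg _).trans (hC 0), fun y => (le_abs_self _).trans (hC y)⟩

/-- The quantity |y| |∇φ(y)| is invariant under rescaling of φ, so one constant serves for all k.
This is why `integral_fderiv_mul_eq_neg` asks for integrability of g h / |y|. -/
theorem exists_norm_fderiv_cutoff_le (n : ℕ) :
    ∃ C, 0 ≤ C ∧ ∀ (k : ℝ) (y : E n), 0 < k → y ≠ 0 → ‖fderiv ℝ (cutoff n k) y‖ ≤ C / ‖y‖ := by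
  obtain ⟨C, hC0, hC⟩ := exists_norm_mul_fderiv_bump_le n
  refine ⟨2 * C, by positivity, fun k y hk hy => ?_⟩
  have hy' : 0 < ‖y‖ := norm_pos_iff.2 hy
  have h : Differentiable ℝ (bump n) := (bump n).contDiff.differentiable one_ne_zero
  have hsc : ∀ c : ℝ, 0 < c → ‖fderiv ℝ (fun z : E n => bump n (c • z)) y‖ ≤ C / ‖y‖ := by
    intro c hc
    rw [fderiv_comp_smul, norm_smul, Real.norm_of_nonneg hc.le, le_div_iff₀ hy']
    have := hC (c • y)
    rw [norm_smul, Real.norm_of_nonneg hc.le] at this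
    linarith
  have hd : ∀ c : ℝ, DifferentiableAt ℝ (fun z : E n => bump n (c • z)) y := fun c =>
    (h _).comp y ((differentiable_id.const_smul c) y)
  have e : cutoff n k = (fun z => bump n (k⁻¹ • z)) * (fun z => 1 - bump n (k • z)) := rfl
  rw [e, fderiv_mul (hd _) ((hd _).const_sub 1), fderiv_const_sub]
  have h1 : ‖(bump n (k⁻¹ • y) : ℝ)‖ ≤ 1 := by
    rw [Real.norm_of_nonneg (bump n).nonneg]; exact (bump n).le_one
  have h2 : ‖(1 - bump n (k • y) : ℝ)‖ ≤ 1 := by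
    rw [Real.norm_of_nonneg (sub_nonneg.2 (bump n).le_one)]
    exact sub_le_self _ (bump n).nonneg
  calc _ ≤ _ := norm_add_le _ _
    _ ≤ 1 * (C / ‖y‖) + 1 * (C / ‖y‖) := by
        rw [norm_smul, norm_smul, norm_neg]
        gcongr
        · exact hsc _ hk
        · exact hsc _ (by positivity)
    _ = _ := by ring

/-- Integration by parts against a function that is locally Lipschitz away from the origin. -/
theorem integral_fderiv_mul_eq_neg {g h : E n → ℝ} (v : E n) (hg : ContDiff ℝ 1 g)
    (hh : LocallyLipschitzOn {0}ᶜ h) (i1 : Integrable fun y => fderiv ℝ g y v * h y)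
    (i2 : Integrable fun y => g y * fderiv ℝ h y v)
    (i3 : Integrable fun y => g y * h y * ‖y‖⁻¹) :
    ∫ y, fderiv ℝ g y v * h y = -∫ y, g y * fderiv ℝ h y v := by
  obtain ⟨C, hC0, hC⟩ := exists_norm_fderiv_cutoff_le n
  have hdc : ∀ k, Differentiable ℝ (cutoff n k) := fun k =>
    (contDiff_cutoff k).differentiable one_ne_zero
  have hdg := hg.differentiable one_ne_zero
  have hne : ∀ᵐ y : E n, y ≠ 0 := by simp [ae_iff]
  have hd3 : ∀ k : ℝ, Measurable fun y => fderiv ℝ (cutoff n k) y v := fun k =>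
    measurable_fderiv_apply_const ℝ _ v
  have hcm : ∀ k : ℝ, AEStronglyMeasurable (cutoff n k) volume := fun k =>
    (contDiff_cutoff k).continuous.aestronglyMeasurable
  have hmh : AEStronglyMeasurable h volume := by
    have := hh.continuousOn.aestronglyMeasurable (μ := (volume : Measure (E n)))
      (measurableSet_singleton 0).compl
    rwa [restrict_compl_singleton] at this
  -- the identity for the functions cut off
  have key : ∀ k : ℝ, 0 < k →
      (∫ y, cutoff n k y * (fderiv ℝ g y v * h y)) +
        ∫ y, fderiv ℝ (cutoff n k) y v * (g y * h y) =
      -∫ y, cutoff n k y * (g y * fderiv ℝ h y v) := by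
    intro k hk
    -- The annulus is wider than the support of the cut-off, so a global Lipschitz extension H of h
    -- from A agrees with h near every point where the cut-off is nonzero.
    set A : Set (E n) := Metric.closedBall 0 (3 * k) \ Metric.ball 0 (1 / (2 * k)) with hA
    have hAc : IsCompact A := (isCompact_closedBall _ _).diff Metric.isOpen_ball
    have hA0 : A ⊆ {0}ᶜ := by
      rintro y ⟨-, hy⟩ rfl
      exact hy (Metric.mem_ball_self (by positivity))
    obtain ⟨K, hK⟩ := (hh.mono hA0).exists_lipschitzOnWith_of_compact hAc
    obtain ⟨H, hHl, hHe⟩ := hK.extend_real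
    have hout : ∀ y : E n, cutoff n k y ≠ 0 → 1 / k < ‖y‖ ∧ ‖y‖ < 2 * k := fun y hy =>
      ⟨not_le.1 fun h => hy (cutoff_eq_zero_of_le hk h),
        not_le.1 fun h => hy (cutoff_eq_zero_of_ge hk h)⟩
    have hkk : 1 / (2 * k) < 1 / k := by
      rw [div_lt_div_iff₀ (by positivity) hk]; linarith
    have hin : ∀ y : E n, 1 / (2 * k) < ‖y‖ → ‖y‖ < 3 * k → y ∈ A := fun y h1 h2 => by
      simp only [hA, Set.mem_sdiff, Metric.mem_closedBall, Metric.mem_ball, dist_zero_right, not_lt]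
      exact ⟨h2.le, h1.le⟩
    have hev : ∀ y : E n, cutoff n k y ≠ 0 → H =ᶠ[𝓝 y] h := fun y hy => by
      obtain ⟨h1, h2⟩ := hout y hy
      filter_upwards [continuous_norm.continuousAt.eventually (lt_mem_nhds (hkk.trans h1)),
        continuous_norm.continuousAt.eventually
          (gt_mem_nhds (show ‖y‖ < 3 * k by linarith))] with z hz1 hz2
      exact (hHe (hin z hz1 hz2)).symm
    have hcs : HasCompactSupport (cutoff n k) :=
      HasCompactSupport.of_support_subset_isCompact (isCompact_closedBall 0 (2 * k))
        fun y hy => by simpa using (hout y hy).2.le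
    have hcg : HasCompactSupport (cutoff n k * g) := hcs.mul_right
    obtain ⟨D, hD⟩ := ((contDiff_cutoff k).mul hg).lipschitzWith_of_hasCompactSupport hcg one_ne_zero
    have main := hHl.integral_lineDeriv_mul_eq (μ := volume) hD hcg v
    have e1 : ∀ᵐ y : E n, lineDeriv ℝ H y v * (cutoff n k * g) y =
        cutoff n k y * (g y * fderiv ℝ h y v) := by
      filter_upwards [hHl.ae_differentiableAt] with y hy
      by_cases hc : cutoff n k y = 0
      · simp [hc]
      · rw [hy.lineDeriv_eq_fderiv, (hev y hc).fderiv_eq]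
        simp only [Pi.mul_apply]; ring
    have e2 : ∀ y : E n, lineDeriv ℝ (cutoff n k * g) y (-v) * H y =
        -(cutoff n k y * (fderiv ℝ g y v * h y) + fderiv ℝ (cutoff n k) y v * (g y * h y)) := by
      intro y
      rw [((hdc k y).mul (hdg y)).lineDeriv_eq_fderiv, fderiv_mul (hdc k y) (hdg y)]
      have e3 : ∀ w : ℝ, cutoff n k y * w * H y = cutoff n k y * w * h y := fun w => by
        by_cases hc : cutoff n k y = 0
        · simp [hc]
        · rw [(hev y hc).eq_of_nhds]
      -- Here the case split is on A. Off A the cut-off vanishes in a whole neighbourhood, so its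
      -- derivative vanishes too.
      have e4 : fderiv ℝ (cutoff n k) y v * H y = fderiv ℝ (cutoff n k) y v * h y := by
        by_cases hc : y ∈ A
        · rw [hHe hc]
        · have : cutoff n k =ᶠ[𝓝 y] fun _ => 0 := by
            filter_upwards [(hAc.isClosed.isOpen_compl).mem_nhds hc] with z hz
            by_contra hne
            obtain ⟨h1, h2⟩ := hout z hne
            exact hz (hin z (hkk.trans h1) (by linarith))
          rw [this.fderiv_eq]; simp
      have e3' := e3 (fderiv ℝ g y v)
      simp
      linear_combination -e3' - g y * e4
    rw [integral_congr_ae e1, integral_congr_ae (.of_forall e2), integral_neg] at main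
    rw [main, neg_neg, integral_add]
    · exact i1.bdd_mul (c := 1) (hcm k) (.of_forall fun y => by
        rw [Real.norm_of_nonneg (cutoff_nonneg k y)]; exact cutoff_le_one k y)
    · refine (i3.norm.const_mul (C * ‖v‖)).mono'
        ((hd3 k).aestronglyMeasurable.mul (hg.continuous.aestronglyMeasurable.mul hmh)) ?_
      filter_upwards [hne] with y hy
      rw [norm_mul, norm_mul (g y * h y), norm_inv, norm_norm]
      calc _ ≤ (C / ‖y‖ * ‖v‖) * ‖g y * h y‖ := by
            gcongr
            exact ((fderiv ℝ (cutoff n k) y).le_opNorm v).trans (by gcongr; exact hC k y hk hy)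
        _ = _ := by rw [div_eq_mul_inv]; ring
  have hk0 : ∀ᶠ k : ℝ in atTop, 0 < k := eventually_gt_atTop 0
  have hev : ∀ y : E n, y ≠ 0 → ∀ᶠ k : ℝ in atTop, 0 < k ∧ 2 / k < ‖y‖ ∧ ‖y‖ < k := by
    intro y hy
    have hy' : 0 < ‖y‖ := norm_pos_iff.2 hy
    filter_upwards [hk0, eventually_gt_atTop (2 / ‖y‖), eventually_gt_atTop ‖y‖] with k h0 h1 h2
    refine ⟨h0, ?_, h2⟩
    rw [div_lt_iff₀ h0]
    rwa [div_lt_iff₀ hy', mul_comm] at h1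
  have lim : ∀ w : E n → ℝ, Integrable w →
      Tendsto (fun k : ℝ => ∫ y, cutoff n k y * w y) atTop (𝓝 (∫ y, w y)) := by
    intro w hw
    refine tendsto_integral_filter_of_dominated_convergence (fun y => ‖w y‖)
      (.of_forall fun k => (hcm k).mul hw.1) (.of_forall fun k => .of_forall fun y => ?_)
      hw.norm ?_
    · rw [norm_mul, Real.norm_of_nonneg (cutoff_nonneg k y)]
      exact mul_le_of_le_one_left (norm_nonneg _) (cutoff_le_one k y)
    · filter_upwards [hne] with y hy
      refine tendsto_const_nhds.congr' ?_
      filter_upwards [hev y hy] with k hk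
      rw [cutoff_eq_one hk.1 hk.2.1.le hk.2.2.le, one_mul]
  -- At each y ≠ 0 the derivative of the cut-off is eventually zero, and C / |y| bounds it
  -- throughout, so dominated convergence applies with `i3`.
  have lim3 : Tendsto (fun k : ℝ => ∫ y, fderiv ℝ (cutoff n k) y v * (g y * h y)) atTop (𝓝 0) := by
    rw [← integral_zero (E n) ℝ (μ := volume)]
    refine tendsto_integral_filter_of_dominated_convergence
      (fun y => C * ‖v‖ * ‖g y * h y * ‖y‖⁻¹‖)
      (.of_forall fun k =>
        (hd3 k).aestronglyMeasurable.mul (hg.continuous.aestronglyMeasurable.mul hmh)) ?_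
      (i3.norm.const_mul _) ?_
    · filter_upwards [hk0] with k hk
      filter_upwards [hne] with y hy
      rw [norm_mul, norm_mul (g y * h y), norm_inv, norm_norm]
      calc _ ≤ (C / ‖y‖ * ‖v‖) * ‖g y * h y‖ := by
            gcongr
            exact ((fderiv ℝ (cutoff n k) y).le_opNorm v).trans (by gcongr; exact hC k y hk hy)
        _ = _ := by rw [div_eq_mul_inv]; ring
    · filter_upwards [hne] with y hy
      refine tendsto_const_nhds.congr' ?_
      filter_upwards [hev y hy] with k hk
      rw [fderiv_cutoff_eq_zero hk.1 hk.2.1 hk.2.2]; simp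
  have l1 := (lim _ i1).add lim3
  have l2 := (lim _ i2).neg
  rw [add_zero] at l1
  refine tendsto_nhds_unique l1 (l2.congr' ?_)
  filter_upwards [hk0] with k hk
  exact (key k hk).symm

/-! ### Homogeneous functions. -/

theorem ae_ne (a : E n) : ∀ᵐ y : E n, y ≠ a := by simp [ae_iff]

theorem isOpen_compl_zero : IsOpen ({0}ᶜ : Set (E n)) := isOpen_compl_singleton

/-- `h` is homogeneous of degree `k` away from the origin. -/
def IsHom (k : ℤ) (h : E n → ℝ) : Prop :=
  ∀ (r : ℝ) (y : E n), 0 < r → y ≠ 0 → h (r • y) = r ^ k * h y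

/-- Differentiate h(rz) = r^k h(z) in z. No differentiability is needed, since both scaling rules
also hold where `fderiv` takes its default value 0; this matters for Lipschitz data, which are
differentiable only almost everywhere. -/
theorem IsHom.fderiv_smul {k : ℤ} {h : E n → ℝ} (hh : IsHom k h) {r : ℝ} {y : E n} (hr : 0 < r)
    (hy : y ≠ 0) : fderiv ℝ h (r • y) = r ^ (k - 1) • fderiv ℝ h y := by
  have h1 : (fun z => h (r • z)) =ᶠ[𝓝 y] r ^ k • h := by
    filter_upwards [isOpen_compl_zero.mem_nhds hy] with z hz
    exact hh r z hr hz
  have h2 := h1.fderiv_eq (𝕜 := ℝ)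
  rw [fderiv_comp_smul, fderiv_const_smul_field] at h2
  rw [Pi.smul_apply] at h2
  rw [zpow_sub_one₀ hr.ne', mul_comm, mul_smul, ← h2, inv_smul_smul₀ hr.ne']

theorem IsHom.fderiv_apply {k : ℤ} {h : E n → ℝ} (hh : IsHom k h) (v : E n) :
    IsHom (k - 1) fun y => fderiv ℝ h y v := fun r y hr hy => by
  simp only [hh.fderiv_smul hr hy]; rfl

theorem IsHom.eq_norm_zpow_mul {k : ℤ} {h : E n → ℝ} (hh : IsHom k h) {y : E n} (hy : y ≠ 0) :
    h y = ‖y‖ ^ k * h (‖y‖⁻¹ • y) := by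
  have h0 : 0 < ‖y‖ := norm_pos_iff.2 hy
  have := hh ‖y‖ (‖y‖⁻¹ • y) h0 (smul_ne_zero (by positivity) hy)
  rwa [smul_inv_smul₀ h0.ne'] at this

theorem IsHom.exists_bound {k : ℤ} {h : E n → ℝ} (hh : IsHom k h) (hc : ContinuousOn h {0}ᶜ) :
    ∃ C, 0 ≤ C ∧ ∀ y, y ≠ 0 → |h y| ≤ C * ‖y‖ ^ k := by
  obtain ⟨C, hC⟩ := (isCompact_sphere (0 : E n) 1).exists_bound_of_continuousOn
    (hc.mono fun y hy => by
      rintro rfl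
      simp at hy)
  refine ⟨|C|, abs_nonneg _, fun y hy => ?_⟩
  rw [hh.eq_norm_zpow_mul hy, abs_mul, abs_of_nonneg (zpow_nonneg (norm_nonneg y) k), mul_comm]
  exact mul_le_mul_of_nonneg_right ((hC _ (normalize_mem hy)).trans (le_abs_self C))
    (zpow_nonneg (norm_nonneg y) k)

theorem aestronglyMeasurable_of_continuousOn {h : E n → ℝ} (hc : ContinuousOn h {0}ᶜ) :
    AEStronglyMeasurable h volume := by
  have := hc.aestronglyMeasurable (μ := (volume : Measure (E n))) (measurableSet_singleton 0).compl
  rwa [restrict_compl_singleton] at this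

/-! ### Integration by parts of the kernels against homogeneous data. -/

theorem integrable_mul_of_bounds {g h : E n → ℝ} (a b : ℕ) {C C' : ℝ}
    (hgm : AEStronglyMeasurable g volume) (hhm : AEStronglyMeasurable h volume)
    (hg : ∀ y, |g y| ≤ C * ((1 + ‖y‖)⁻¹) ^ b) (hh : ∀ y, y ≠ 0 → |h y| ≤ C' * (‖y‖ ^ a)⁻¹)
    (ha : a < n + 1) (hab : n + 1 < a + b) : Integrable fun y => g y * h y := by
  refine ((integrable_inv_norm_pow_mul ha hab).const_mul (C * C')).mono' (hgm.mul hhm) ?_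
  filter_upwards [ae_ne 0] with y hy
  rw [Real.norm_eq_abs, abs_mul]
  calc _ ≤ (C * ((1 + ‖y‖)⁻¹) ^ b) * (C' * (‖y‖ ^ a)⁻¹) :=
        mul_le_mul (hg y) (hh y hy) (abs_nonneg _) ((abs_nonneg _).trans (hg y))
    _ = _ := by rw [inv_pow]; ring

theorem invNorm_sub_pow_le (hε : 0 < ε) (x : S n) (k : ℕ) (y : E n) :
    invNorm ε (y - (x : E n)) ^ k ≤ (2 / ε + 1) ^ k * ((1 + ‖y‖)⁻¹) ^ k := by
  rw [← mul_pow]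
  exact pow_le_pow_left₀ (invNorm_nonneg _) (invNorm_sub_le hε (by simp) y) k

theorem exists_gradKer_le (hε : 0 < ε) (x : S n) (v : E n) :
    ∃ C, ∀ y : E n, |gradKer ε v (y - (x : E n))| ≤ C * ((1 + ‖y‖)⁻¹) ^ n :=
  ⟨‖v‖ * (2 / ε + 1) ^ n, fun y => (abs_gradKer_le _ _).trans (by
    rw [mul_assoc]; gcongr; exact invNorm_sub_pow_le hε x n y)⟩

theorem exists_hessKer_le (hε : 0 < ε) (x : S n) (v w : E n) :
    ∃ C, ∀ y : E n, |hessKer ε v w (y - (x : E n))| ≤ C * ((1 + ‖y‖)⁻¹) ^ (n + 1) :=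
  ⟨(n + 2) * (‖v‖ * ‖w‖) * (2 / ε + 1) ^ (n + 1), fun y => (abs_hessKer_le _ _ _).trans (by
    rw [mul_assoc _ ((2 / ε + 1) ^ (n + 1))]; gcongr; exact invNorm_sub_pow_le hε x (n + 1) y)⟩

theorem exists_thirdKer_le (hε : 0 < ε) (x : S n) (v w t : E n) :
    ∃ C, ∀ y : E n, |thirdKer ε v w t (y - (x : E n))| ≤ C * ((1 + ‖y‖)⁻¹) ^ (n + 2) :=
  ⟨((n + 1) * 3 + (n + 1) * (n + 3)) * (‖v‖ * ‖w‖ * ‖t‖) * (2 / ε + 1) ^ (n + 2),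
    fun y => (abs_thirdKer_le _ _ _ _).trans (by
    rw [mul_assoc _ ((2 / ε + 1) ^ (n + 2))]; gcongr; exact invNorm_sub_pow_le hε x (n + 2) y)⟩

/-- Meant for h a first derivative of U, of degree 0. All products decay like |y|^{-(n+2)}, one
power more than integrability at infinity requires. -/
theorem integral_hessKer_mul_fderiv (hn : 2 ≤ n) (hε : 0 < ε) (x : S n) (a b c : E n) {h : E n → ℝ}
    (hh : LocallyLipschitzOn {0}ᶜ h) {C C' : ℝ} (hC : ∀ y, y ≠ 0 → |h y| ≤ C)
    (hC' : ∀ y, y ≠ 0 → |fderiv ℝ h y c| ≤ C' * ‖y‖⁻¹) :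
    ∫ y, hessKer ε a b (y - (x : E n)) * fderiv ℝ h y c = -∫ y, thirdKer ε a b c (y - (x : E n)) * h y := by
  have hg : ContDiff ℝ 1 fun y => hessKer ε a b (y - (x : E n)) :=
    (contDiff_hessKer hε a b).comp (contDiff_id.sub contDiff_const)
  have hd : ∀ y, fderiv ℝ (fun y => hessKer ε a b (y - (x : E n))) y c = thirdKer ε a b c (y - (x : E n)) :=
    fun y => by rw [fderiv_comp_sub, fderiv_hessKer hε]
  obtain ⟨C1, h1⟩ := exists_hessKer_le hε x a b
  obtain ⟨C2, h2⟩ := exists_thirdKer_le hε x a b c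
  have hm1 : AEStronglyMeasurable (fun y => hessKer ε a b (y - (x : E n))) volume :=
    hg.continuous.aestronglyMeasurable
  have hm2 : AEStronglyMeasurable (fun y : E n => thirdKer ε a b c (y - (x : E n))) volume :=
    Measurable.aestronglyMeasurable (by fun_prop)
  have hmh := aestronglyMeasurable_of_continuousOn hh.continuousOn
  have := integral_fderiv_mul_eq_neg c hg hh ?_ ?_ ?_
  · simp only [hd] at this
    rw [this, neg_neg]
  · simp only [hd]
    exact integrable_mul_of_bounds 0 (n + 2) hm2 hmh h2 (C' := C) (by simpa using hC) (by omega)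
      (by omega)
  · exact integrable_mul_of_bounds 1 (n + 1) hm1
      (measurable_fderiv_apply_const ℝ h c).aestronglyMeasurable h1 (C' := C') (by simpa using hC')
      (by omega) (by omega)
  · simp only [mul_assoc]
    refine integrable_mul_of_bounds 1 (n + 1) hm1 (hmh.mul (by fun_prop)) h1 (C' := C) ?_
      (by omega) (by omega)
    intro y hy
    rw [abs_mul, abs_inv, abs_norm, pow_one]
    gcongr
    exact hC y hy

/-- Meant for h = F, of degree -1. The decay is again |y|^{-(n+2)}, but the singularity at the
origin is now |y|^{-2}, integrable because n ≥ 2. -/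
theorem integral_gradKer_mul_fderiv (hn : 2 ≤ n) (hε : 0 < ε) (x : S n) (a c : E n) {h : E n → ℝ}
    (hh : LocallyLipschitzOn {0}ᶜ h) {C C' : ℝ} (hC : ∀ y, y ≠ 0 → |h y| ≤ C * ‖y‖⁻¹)
    (hC' : ∀ y, y ≠ 0 → |fderiv ℝ h y c| ≤ C' * (‖y‖ ^ 2)⁻¹) :
    ∫ y, hessKer ε a c (y - (x : E n)) * h y = -∫ y, gradKer ε a (y - (x : E n)) * fderiv ℝ h y c := by
  have hg : ContDiff ℝ 1 fun y => gradKer ε a (y - (x : E n)) :=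
    (contDiff_gradKer hε a).comp (contDiff_id.sub contDiff_const)
  have hd : ∀ y, fderiv ℝ (fun y => gradKer ε a (y - (x : E n))) y c = hessKer ε a c (y - (x : E n)) :=
    fun y => by rw [fderiv_comp_sub, fderiv_gradKer hε]
  obtain ⟨C1, h1⟩ := exists_gradKer_le hε x a
  obtain ⟨C2, h2⟩ := exists_hessKer_le hε x a c
  have hm1 : AEStronglyMeasurable (fun y => gradKer ε a (y - (x : E n))) volume :=
    hg.continuous.aestronglyMeasurable
  have hm2 : AEStronglyMeasurable (fun y : E n => hessKer ε a c (y - (x : E n))) volume :=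
    Measurable.aestronglyMeasurable (by fun_prop)
  have hmh := aestronglyMeasurable_of_continuousOn hh.continuousOn
  have := integral_fderiv_mul_eq_neg c hg hh ?_ ?_ ?_
  · simpa only [hd] using this
  · simp only [hd]
    exact integrable_mul_of_bounds 1 (n + 1) hm2 hmh h2 (C' := C) (by simpa using hC) (by omega)
      (by omega)
  · exact integrable_mul_of_bounds 2 n hm1
      (measurable_fderiv_apply_const ℝ h c).aestronglyMeasurable h1 (C' := C') hC'
      (by omega) (by omega)
  · simp only [mul_assoc]
    refine integrable_mul_of_bounds 2 n hm1 (hmh.mul (by fun_prop)) h1 (C' := C) ?_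
      (by omega) (by omega)
    intro y hy
    rw [abs_mul, abs_inv, abs_norm, sq, mul_inv, ← mul_assoc]
    gcongr
    exact hC y hy

/-! ### Exchanging second derivatives between the kernel and U. -/

/-- The derivatives of second order of a function. -/
noncomputable def hess (U : E n → ℝ) (v w y : E n) : ℝ :=
  fderiv ℝ (fun z => fderiv ℝ U z v) y w

theorem differentiableAt_fderiv {U : E n → ℝ} (hU : ContDiffOn ℝ 2 U {0}ᶜ) {y : E n}
    (hy : y ≠ 0) : DifferentiableAt ℝ (fderiv ℝ U) y :=
  ((hU.contDiffAt (isOpen_compl_zero.mem_nhds hy)).fderiv_right (m := 1) (by norm_num)).differentiableAt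
    one_ne_zero

theorem hess_eq {U : E n → ℝ} (hU : ContDiffOn ℝ 2 U {0}ᶜ) (v w : E n) {y : E n} (hy : y ≠ 0) :
    hess U v w y = fderiv ℝ (fderiv ℝ U) y w v := by
  unfold hess
  rw [fderiv_clm_apply (differentiableAt_fderiv hU hy) (differentiableAt_const v)]
  simp

theorem hess_comm {U : E n → ℝ} (hU : ContDiffOn ℝ 2 U {0}ᶜ) (v w : E n) {y : E n} (hy : y ≠ 0) :
    hess U v w y = hess U w v y := by
  rw [hess_eq hU v w hy, hess_eq hU w v hy]
  exact (hU.contDiffAt (isOpen_compl_zero.mem_nhds hy)).isSymmSndFDerivAt (by simp) _ _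

theorem contDiffAt_fderiv_apply {U : E n → ℝ} (hU : ContDiffOn ℝ 2 U {0}ᶜ) (v : E n) {y : E n}
    (hy : y ≠ 0) : ContDiffAt ℝ 1 (fun z => fderiv ℝ U z v) y :=
  ((hU.contDiffAt (isOpen_compl_zero.mem_nhds hy)).fderiv_right (m := 1) (by norm_num)).clm_apply
    contDiffAt_const

theorem locallyLipschitzOn_fderiv_apply {U : E n → ℝ} (hU : ContDiffOn ℝ 2 U {0}ᶜ) (v : E n) :
    LocallyLipschitzOn {0}ᶜ (fun z => fderiv ℝ U z v) := fun y hy => by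
  obtain ⟨K, t, ht, h⟩ := (contDiffAt_fderiv_apply hU v hy).exists_lipschitzOnWith
  exact ⟨K, t, mem_nhdsWithin_of_mem_nhds ht, h⟩

theorem continuousOn_hess {U : E n → ℝ} (hU : ContDiffOn ℝ 2 U {0}ᶜ) (v w : E n) :
    ContinuousOn (hess U v w) {0}ᶜ := fun y hy =>
  (((contDiffAt_fderiv_apply hU v hy).fderiv_right (m := 0) (by norm_num)).clm_apply
    contDiffAt_const).continuousAt.continuousWithinAt

theorem exists_fderiv_bound {U : E n → ℝ} (hU : ContDiffOn ℝ 2 U {0}ᶜ) (hom : IsHom 1 U) (v : E n) :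
    ∃ C, ∀ y, y ≠ 0 → |fderiv ℝ U y v| ≤ C := by
  obtain ⟨C, -, hC⟩ := (hom.fderiv_apply v).exists_bound
    (locallyLipschitzOn_fderiv_apply hU v).continuousOn
  exact ⟨C, by simpa using hC⟩

theorem exists_hess_bound {U : E n → ℝ} (hU : ContDiffOn ℝ 2 U {0}ᶜ) (hom : IsHom 1 U)
    (v w : E n) : ∃ C, ∀ y, y ≠ 0 → |hess U v w y| ≤ C * ‖y‖⁻¹ := by
  obtain ⟨C, -, hC⟩ := ((hom.fderiv_apply v).fderiv_apply w).exists_bound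
    (continuousOn_hess hU v w)
  exact ⟨C, by simpa [hess] using hC⟩

theorem integrable_hessKer_mul_hess (hn : 2 ≤ n) (hε : 0 < ε) (x : S n) {U : E n → ℝ}
    (hU : ContDiffOn ℝ 2 U {0}ᶜ) (hom : IsHom 1 U) (a b c d : E n) :
    Integrable fun y => hessKer ε a b (y - (x : E n)) * hess U c d y := by
  obtain ⟨C1, h1⟩ := exists_hessKer_le hε x a b
  obtain ⟨C2, h2⟩ := exists_hess_bound hU hom c d
  exact integrable_mul_of_bounds 1 (n + 1) (Measurable.aestronglyMeasurable (by fun_prop))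
    (measurable_fderiv_apply_const ℝ _ d).aestronglyMeasurable h1 (C' := C2) (by simpa using h2)
    (by omega) (by omega)

/-- U is only C², so the third derivative must fall on the kernel. Moving one derivative off U,
permuting the indices of `thirdKer` and moving one back exchanges aa|bb for ab|ba; after the
symmetry of D²U a second round gives bb|aa. -/
theorem integral_hessKer_mul_hess_swap (hn : 2 ≤ n) (hε : 0 < ε) (x : S n) {U : E n → ℝ}
    (hU : ContDiffOn ℝ 2 U {0}ᶜ) (hom : IsHom 1 U) (a b : E n) :
    ∫ y, hessKer ε a a (y - (x : E n)) * hess U b b y = ∫ y, hessKer ε b b (y - (x : E n)) * hess U a a y := by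
  have key : ∀ p q v w : E n, ∫ y, hessKer ε p q (y - (x : E n)) * hess U v w y =
      -∫ y, thirdKer ε p q w (y - (x : E n)) * fderiv ℝ U y v := fun p q v w => by
    obtain ⟨C1, h1⟩ := exists_fderiv_bound hU hom v
    obtain ⟨C2, h2⟩ := exists_hess_bound hU hom v w
    exact integral_hessKer_mul_fderiv hn hε x p q w (locallyLipschitzOn_fderiv_apply hU v) h1 h2
  have hs : ∫ y, hessKer ε a b (y - (x : E n)) * hess U b a y =
      ∫ y, hessKer ε a b (y - (x : E n)) * hess U a b y := by
    refine integral_congr_ae ?_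
    filter_upwards [ae_ne 0] with y hy
    rw [hess_comm hU b a hy]
  calc ∫ y, hessKer ε a a (y - (x : E n)) * hess U b b y
      = -∫ y, thirdKer ε a a b (y - (x : E n)) * fderiv ℝ U y b := key _ _ _ _
    _ = -∫ y, thirdKer ε a b a (y - (x : E n)) * fderiv ℝ U y b := by simp only [thirdKer_swap a a b]
    _ = ∫ y, hessKer ε a b (y - (x : E n)) * hess U b a y := (key _ _ _ _).symm
    _ = ∫ y, hessKer ε a b (y - (x : E n)) * hess U a b y := hs
    _ = -∫ y, thirdKer ε a b b (y - (x : E n)) * fderiv ℝ U y a := key _ _ _ _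
    _ = -∫ y, thirdKer ε b b a (y - (x : E n)) * fderiv ℝ U y a := by
        simp only [thirdKer_swap_left a b b, thirdKer_swap b a b]
    _ = ∫ y, hessKer ε b b (y - (x : E n)) * hess U a a y := (key _ _ _ _).symm

theorem integral_approx_mul_hess (hn : 2 ≤ n) (hε : 0 < ε) (x : S n) {U F : E n → ℝ}
    (hU : ContDiffOn ℝ 2 U {0}ᶜ) (hom : IsHom 1 U) (ξ : E n)
    (b : OrthonormalBasis (Fin (n + 1)) ℝ (E n))
    (hF : ∀ y, y ≠ 0 → ∑ i, hess U (b i) (b i) y = F y) :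
    ∫ y, ((n + 1) * ε ^ 2 * invNorm ε (y - (x : E n)) ^ (n + 3)) * hess U ξ ξ y =
      ∫ y, hessKer ε ξ ξ (y - (x : E n)) * F y := by
  have h1 : ∀ᵐ y : E n, hessKer ε ξ ξ (y - (x : E n)) * F y =
      ∑ i, hessKer ε ξ ξ (y - (x : E n)) * hess U (b i) (b i) y := by
    filter_upwards [ae_ne 0] with y hy
    rw [← hF y hy, Finset.mul_sum]
  rw [integral_congr_ae h1, integral_finsetSum _ fun i _ =>
    integrable_hessKer_mul_hess hn hε x hU hom _ _ _ _]
  simp only [← sum_hessKer hε b, Finset.sum_mul]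
  rw [integral_finsetSum _ fun i _ => integrable_hessKer_mul_hess hn hε x hU hom _ _ _ _]
  exact Finset.sum_congr rfl fun i _ => integral_hessKer_mul_hess_swap hn hε x hU hom _ _

/-! ### The Laplacian of the kernel as an approximate identity. -/

theorem area_pos (n : ℕ) : 0 < area n := by
  rw [area, surf, Measure.toSphere_real_apply_univ, finrank_E]
  have : 0 < (volume : Measure (E n)).real (Metric.ball 0 1) :=
    ENNReal.toReal_pos (Metric.measure_ball_pos _ _ one_pos).ne' measure_ball_lt_top.ne
  positivity

/-- The Laplacian of the regularised fundamental solution has total mass `|S^n|`. -/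
theorem integral_approx (n : ℕ) :
    ∫ y : E n, (n + 1) * invNorm 1 y ^ (n + 3) = area n := by
  set s : ℝ → ℝ := fun r => (√(r ^ 2 + 1))⁻¹ with hs
  have hpos : ∀ r, 0 < s r := fun r => by positivity
  have hsq : ∀ r, (r ^ 2 + 1) * s r ^ 2 = 1 := fun r => by
    simp only [hs, inv_pow]
    rw [Real.sq_sqrt (by positivity)]
    exact mul_inv_cancel₀ (by positivity)
  have hd : ∀ r, HasDerivAt s (-(r * s r ^ 3)) r := fun r => by
    have h0 : √(r ^ 2 + 1) ≠ 0 := by positivity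
    have h1 : HasDerivAt (fun r : ℝ => r ^ 2 + 1) (2 * r) r := by
      simpa using (hasDerivAt_pow 2 r).add_const 1
    refine ((h1.sqrt (by positivity)).inv h0).congr_deriv ?_
    simp only [hs]
    field_simp
  -- With s = (r² + 1)^{-1/2}, the radial integrand has the explicit primitive (rs)^{n+1}, which
  -- rises from 0 to 1.
  have hG : ∀ r ∈ Ici (0 : ℝ), HasDerivAt (fun r => (r * s r) ^ (n + 1))
      (r ^ n * ((n + 1) * s r ^ (n + 3))) r := fun r _ => by
    refine (((hasDerivAt_id r).mul (hd r)).pow (n + 1)).congr_deriv ?_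
    have := hsq r
    simp only [Pi.mul_apply, id, Nat.add_sub_cancel]
    push_cast
    linear_combination (-(n + 1) * r ^ n * s r ^ (n + 1)) * this
  have hlim : Tendsto (fun r => (r * s r) ^ (n + 1)) atTop (𝓝 1) := by
    have h1 : Tendsto (fun r : ℝ => √((1 + (r ^ 2)⁻¹))⁻¹) atTop (𝓝 (√((1 + 0))⁻¹)) := by
      refine Tendsto.sqrt (Tendsto.inv₀ (tendsto_const_nhds.add ?_) (by norm_num))
      exact tendsto_inv_atTop_zero.comp (tendsto_pow_atTop two_ne_zero)
    have h2 := h1.pow (n + 1)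
    simp only [add_zero, inv_one, Real.sqrt_one, one_pow] at h2
    refine h2.congr' ?_
    filter_upwards [eventually_gt_atTop 0] with r hr
    congr 1
    rw [show (1 + (r ^ 2)⁻¹)⁻¹ = r ^ 2 * (r ^ 2 + 1)⁻¹ by field_simp,
      Real.sqrt_mul (by positivity), Real.sqrt_sq hr.le, Real.sqrt_inv]
  have hint := integral_Ioi_of_hasDerivAt_of_nonneg' hG (fun r hr => by
    have : 0 < r := hr
    have := hpos r
    positivity) hlim
  have := integral_fun_norm_addHaar (volume : Measure (E n)) (fun r => (n + 1) * s r ^ (n + 3))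
  rw [finrank_E] at this
  simp only [Nat.add_sub_cancel, smul_eq_mul, hint] at this
  rw [area, surf, Measure.toSphere_real_apply_univ, finrank_E]
  simpa [hs, invNorm] using this

/-- Otherwise the integral would have the default value 0, while it equals the positive area. -/
theorem integrable_invNorm_one (n : ℕ) :
    Integrable fun y : E n => (n + 1) * invNorm 1 y ^ (n + 3) :=
  by_contra fun h => (area_pos n).ne' (by rw [← integral_approx, integral_undef h])

theorem invNorm_smul (hε : 0 < ε) (t : E n) : invNorm ε (ε • t) = ε⁻¹ * invNorm 1 t := by
  unfold invNorm
  rw [norm_smul, Real.norm_of_nonneg hε.le,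
    show (ε * ‖t‖) ^ 2 + ε ^ 2 = ε ^ 2 * (‖t‖ ^ 2 + 1 ^ 2) by ring,
    Real.sqrt_mul (by positivity), Real.sqrt_sq hε.le, mul_inv]

/-- The substitution y = x + εt turns the kernel into a fixed integrable function of t, the Jacobian
ε^{n+1} cancelling exactly; then dominated convergence. -/
theorem tendsto_integral_approx_of_bounded (x : E n) {w : E n → ℝ} (hm : Measurable w) {C : ℝ}
    (hC : ∀ y, |w y| ≤ C) (hc : ContinuousAt w x) :
    Tendsto (fun ε => ∫ y, ((n + 1) * ε ^ 2 * invNorm ε (y - x) ^ (n + 3)) * w y) (𝓝[>] 0)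
      (𝓝 (area n * w x)) := by
  have h1 : ∀ ε : ℝ, 0 < ε → ∫ y, ((n + 1) * ε ^ 2 * invNorm ε (y - x) ^ (n + 3)) * w y =
      ∫ t, ((n + 1) * invNorm 1 t ^ (n + 3)) * w (ε • t + x) := fun ε hε => by
    have e1 := integral_add_right_eq_self (μ := (volume : Measure (E n)))
      (fun y => ((n + 1) * ε ^ 2 * invNorm ε (y - x) ^ (n + 3)) * w y) x
    have e2 := Measure.integral_comp_smul_of_nonneg (volume : Measure (E n))
      (fun y => ((n + 1) * ε ^ 2 * invNorm ε (y + x - x) ^ (n + 3)) * w (y + x)) ε (hR := hε.le)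
    rw [← e1]
    rw [finrank_E, smul_eq_mul, inv_mul_eq_div, eq_div_iff (by positivity), mul_comm,
      ← integral_const_mul] at e2
    rw [← e2]
    congr 1
    ext t
    rw [add_sub_cancel_right, invNorm_smul hε, mul_pow, inv_pow]
    field_simp
    ring
  have h2 : Tendsto (fun ε : ℝ => ∫ t, ((n + 1) * invNorm 1 t ^ (n + 3)) * w (ε • t + x)) (𝓝[>] 0)
      (𝓝 (∫ t : E n, ((n + 1) * invNorm 1 t ^ (n + 3)) * w x)) := by
    refine tendsto_integral_filter_of_dominated_convergence
      (fun t => ((n + 1) * invNorm 1 t ^ (n + 3)) * C) (.of_forall fun ε =>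
        Measurable.aestronglyMeasurable (by fun_prop)) (.of_forall fun ε => .of_forall fun t => ?_)
      ((integrable_invNorm_one n).mul_const C) (.of_forall fun t => ?_)
    · have := invNorm_nonneg (ε := 1) t
      rw [norm_mul, Real.norm_of_nonneg (by positivity)]
      gcongr
      exact hC _
    · refine Tendsto.const_mul _ (hc.tendsto.comp ?_)
      have : Tendsto (fun ε : ℝ => ε • t + x) (𝓝 0) (𝓝 ((0 : ℝ) • t + x)) :=
        (tendsto_id.smul_const t).add_const x
      simpa using this.mono_left nhdsWithin_le_nhds
  rw [integral_mul_const, integral_approx] at h2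
  refine h2.congr' ?_
  filter_upwards [self_mem_nhdsWithin] with ε hε
  exact (h1 ε hε).symm

/-- Second derivatives of U blow up at the origin, so w is split at the ball of radius 1/2 about x.
The near part is bounded; on the far part the kernel tends to 0 because of the factor ε². -/
theorem tendsto_integral_approx (hn : 2 ≤ n) (x : S n) {w : E n → ℝ} (hm : Measurable w) {C : ℝ}
    (hC : ∀ y, y ≠ 0 → |w y| ≤ C * ‖y‖⁻¹) (hc : ContinuousAt w x) :
    Tendsto (fun ε => ∫ y, ((n + 1) * ε ^ 2 * invNorm ε (y - (x : E n)) ^ (n + 3)) * w y) (𝓝[>] 0)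
      (𝓝 (area n * w x)) := by
  have hx : ‖(x : E n)‖ = 1 := by simp
  have hC0 : 0 ≤ C := by
    have := (abs_nonneg _).trans (hC x (by simp [← norm_pos_iff]))
    simpa using this
  set A : Set (E n) := Metric.ball (x : E n) (1 / 2) with hA
  have hAm : MeasurableSet A := Metric.isOpen_ball.measurableSet
  have hxA : A ∈ 𝓝 (x : E n) := Metric.ball_mem_nhds _ (by norm_num)
  have hAn : ∀ y ∈ A, 1 / 2 < ‖y‖ := fun y hy => by
    rw [hA, Metric.mem_ball, dist_eq_norm] at hy
    have := norm_sub_norm_le (x : E n) y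
    rw [norm_sub_rev, hx] at this
    linarith
  have hin : ∀ y, |A.indicator w y| ≤ 2 * C := fun y => by
    by_cases hy : y ∈ A
    · have hy' := hAn y hy
      have hy0 : 0 < ‖y‖ := by linarith
      rw [indicator_of_mem hy]
      refine (hC y (norm_pos_iff.1 hy0)).trans ?_
      rw [mul_comm]
      gcongr
      exact inv_le_of_inv_le₀ (by norm_num) (by linarith)
    · rw [indicator_of_notMem hy]; simpa using by positivity
  have t1 := tendsto_integral_approx_of_bounded (x : E n) (hm.indicator hAm) hin
    (hc.congr (by
      filter_upwards [hxA] with y hy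
      exact (indicator_of_mem hy w).symm))
  rw [indicator_of_mem (mem_of_mem_nhds hxA)] at t1
  have hsplit : ∀ y, w y = A.indicator w y + Aᶜ.indicator w y := fun y =>
    (congrFun (indicator_self_add_compl A w) y).symm
  have hφ : ∀ (ε : ℝ), 0 < ε → ∀ y : E n, (n + 1) * ε ^ 2 * invNorm ε y ^ (n + 3) ≤
      (n + 1) * invNorm ε y ^ (n + 1) := fun ε hε y => by
    have h0 := invNorm_nonneg (ε := ε) y
    have h1 := invNorm_sq hε y
    have h2 : ε ^ 2 * invNorm ε y ^ 2 ≤ 1 := by nlinarith [sq_nonneg (‖y‖ * invNorm ε y)]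
    calc (n + 1) * ε ^ 2 * invNorm ε y ^ (n + 3)
        = (n + 1) * invNorm ε y ^ (n + 1) * (ε ^ 2 * invNorm ε y ^ 2) := by ring
      _ ≤ (n + 1) * invNorm ε y ^ (n + 1) * 1 := by gcongr
      _ = _ := mul_one _
  -- Off the ball, 1 + |y| ≤ 2 + |y - x| ≤ 5 |y - x|.
  have hfar : ∀ y ∉ A, ‖y - (x : E n)‖⁻¹ ≤ 5 * (1 + ‖y‖)⁻¹ := fun y hy => by
    rw [hA, Metric.mem_ball, dist_eq_norm, not_lt] at hy
    have : ‖y‖ ≤ 1 + ‖y - (x : E n)‖ := by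
      have := norm_add_le (x : E n) (y - x); simpa [hx] using this
    rw [← div_eq_mul_inv, inv_eq_one_div, div_le_div_iff₀ (by linarith) (by positivity)]
    linarith
  have bnd : ∀ ε : ℝ, 0 < ε → ∀ y,
      ‖((n + 1) * ε ^ 2 * invNorm ε (y - (x : E n)) ^ (n + 3)) * Aᶜ.indicator w y‖ ≤
      ((n + 1) * (5 * (1 + ‖y‖)⁻¹) ^ (n + 1)) * |w y| := fun ε hε y => by
    have h0 := invNorm_nonneg (ε := ε) (y - (x : E n))
    by_cases hy : y ∈ A
    · rw [indicator_of_notMem (by simpa using hy), mul_zero, norm_zero]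
      positivity
    · have hyx : y - (x : E n) ≠ 0 := fun h => hy (by
        rw [sub_eq_zero.1 h]; exact mem_of_mem_nhds hxA)
      rw [indicator_of_mem (by simpa using hy), norm_mul, Real.norm_of_nonneg (by positivity),
        Real.norm_eq_abs]
      refine mul_le_mul_of_nonneg_right ((hφ ε hε _).trans ?_) (abs_nonneg _)
      gcongr
      exact (invNorm_le_inv_norm hyx).trans (hfar y hy)
  have hbi : Integrable fun y => ((n + 1) * (5 * (1 + ‖y‖)⁻¹) ^ (n + 1)) * |w y| := by
    refine integrable_mul_of_bounds 1 (n + 1) (C := (n + 1) * 5 ^ (n + 1)) (C' := C)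
      (Measurable.aestronglyMeasurable (by fun_prop)) hm.norm.aestronglyMeasurable
      (fun y => ?_) (by simpa using hC) (by omega) (by omega)
    rw [abs_of_nonneg (by positivity), mul_pow, mul_assoc]
  have t2 : Tendsto (fun ε => ∫ y, ((n + 1) * ε ^ 2 * invNorm ε (y - (x : E n)) ^ (n + 3)) *
      Aᶜ.indicator w y) (𝓝[>] 0) (𝓝 0) := by
    suffices h : Tendsto (fun ε => ∫ y, ((n + 1) * ε ^ 2 * invNorm ε (y - (x : E n)) ^ (n + 3)) *
      Aᶜ.indicator w y) (𝓝[>] 0) (𝓝 (∫ _ : E n, (0 : ℝ))) by simpa using h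
    refine tendsto_integral_filter_of_dominated_convergence _
      (.of_forall fun ε => (Measurable.aestronglyMeasurable (by fun_prop)).mul
        (hm.indicator hAm.compl).aestronglyMeasurable) ?_ hbi (.of_forall fun y => ?_)
    · filter_upwards [self_mem_nhdsWithin] with ε hε
      exact .of_forall (bnd ε hε)
    · by_cases hy : y ∈ A
      · rw [indicator_of_notMem (by simpa using hy)]; simp
      · have hyx : y - (x : E n) ≠ 0 := fun h => hy (by
          rw [sub_eq_zero.1 h]; exact mem_of_mem_nhds hxA)
        have h1 : Tendsto (fun ε : ℝ => (n + 1) * ε ^ 2 * invNorm ε (y - (x : E n)) ^ (n + 3))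
            (𝓝 0) (𝓝 ((n + 1) * 0 ^ 2 * invNorm 0 (y - (x : E n)) ^ (n + 3))) :=
          ((tendsto_id.pow 2).const_mul _).mul ((tendsto_invNorm hyx).pow _)
        simpa using (h1.mono_left nhdsWithin_le_nhds).mul_const (Aᶜ.indicator w y)
  have t3 := t1.add t2
  rw [add_zero] at t3
  refine t3.congr' ?_
  filter_upwards [self_mem_nhdsWithin] with ε hε
  rw [← integral_add]
  · congr 1
    ext y
    rw [← mul_add, ← hsplit]
  · have hε' : 0 < ε := hε
    refine integrable_mul_of_bounds 1 (n + 1)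
      (C := (n + 1) * (2 / ε + 1) ^ (n + 1)) (C' := C) (Measurable.aestronglyMeasurable
        (by fun_prop)) (hm.indicator hAm).aestronglyMeasurable (fun y => ?_) (fun y hy => ?_)
        (by omega) (by omega)
    · have h0 := invNorm_nonneg (ε := ε) (y - (x : E n))
      rw [abs_of_nonneg (by positivity), mul_assoc _ ((2 / ε + 1) ^ (n + 1))]
      refine (hφ ε hε _).trans ?_
      gcongr
      exact invNorm_sub_pow_le hε x (n + 1) y
    · rw [pow_one]
      refine le_trans ?_ (hC y hy)
      by_cases hy : y ∈ A
      · rw [indicator_of_mem hy]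
      · rw [indicator_of_notMem hy]; simp
  · exact hbi.mono' ((Measurable.aestronglyMeasurable (by fun_prop)).mul
      (hm.indicator hAm.compl).aestronglyMeasurable) (.of_forall (bnd ε hε))

/-! ### Size of the kernels ω and ω̂ near the diagonal. -/

theorem integrable_inv_one_add_abs_pow {k : ℕ} (hk : 2 ≤ k) :
    Integrable fun t : ℝ => ((1 + |t|) ^ k)⁻¹ := by
  have := integrable_one_add_norm (E := ℝ) (μ := volume) (r := (k : ℝ)) (by
    simp only [Module.finrank_self, Nat.cast_one]; exact_mod_cast hk)
  refine this.congr (.of_forall fun t => ?_)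
  simp only [Real.norm_eq_abs]
  rw [Real.rpow_neg (by positivity), Real.rpow_natCast]

theorem inv_add_abs_pow_eq {d : ℝ} (hd : 0 < d) (k : ℕ) (r : ℝ) :
    ((d + |1 - r|) ^ k)⁻¹ = (d ^ k)⁻¹ * ((1 + |(r - 1) / d|) ^ k)⁻¹ := by
  rw [← mul_inv, ← mul_pow, mul_add, mul_one, abs_div, abs_of_pos hd, mul_div_cancel₀ _ hd.ne',
    abs_sub_comm]

theorem integrable_inv_add_abs_pow {d : ℝ} (hd : 0 < d) {k : ℕ} (hk : 2 ≤ k) :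
    Integrable fun r : ℝ => ((d + |1 - r|) ^ k)⁻¹ := by
  simp only [inv_add_abs_pow_eq hd]
  exact (((integrable_inv_one_add_abs_pow hk).comp_div hd.ne').comp_sub_right 1).const_mul _

theorem integral_inv_add_abs_pow {d : ℝ} (hd : 0 < d) (k : ℕ) :
    ∫ r : ℝ, ((d + |1 - r|) ^ k)⁻¹ = (d ^ k)⁻¹ * d * ∫ t : ℝ, ((1 + |t|) ^ k)⁻¹ := by
  simp only [inv_add_abs_pow_eq hd]
  rw [integral_const_mul, integral_sub_right_eq_self (fun r : ℝ => ((1 + |r / d|) ^ k)⁻¹) 1,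
    Measure.integral_comp_div (fun r : ℝ => ((1 + |r|) ^ k)⁻¹) d, abs_of_pos hd, smul_eq_mul,
    mul_assoc]

/-- Both |1 - r| and half of |x - z| are at most |x - rz|. This reduces the kernels to the model
integral of (d + |1 - r|)^{-(n+1)}, which scales like d^{-n}. -/
theorem dist_add_abs_le (x z : S n) {r : ℝ} (hr : 0 < r) :
    ‖(x : E n) - z‖ + |1 - r| ≤ 3 * ‖(x : E n) - r • (z : E n)‖ := by
  have hx : ‖(x : E n)‖ = 1 := by simp
  have hz : ‖(z : E n)‖ = 1 := by simp
  have h1 : |1 - r| ≤ ‖(x : E n) - r • (z : E n)‖ := by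
    have := abs_norm_sub_norm_le (x : E n) (r • (z : E n))
    rwa [hx, norm_smul, hz, mul_one, Real.norm_of_nonneg hr.le] at this
  have h2 : ‖(x : E n) - z‖ ≤ ‖(x : E n) - r • (z : E n)‖ + |1 - r| := by
    have := norm_sub_le ((x : E n) - r • (z : E n)) ((1 - r) • (z : E n))
    rwa [norm_smul, hz, mul_one, Real.norm_eq_abs, sub_smul, one_smul,
      show (x : E n) - r • (z : E n) - (z - r • (z : E n)) = x - z by abel] at this
  linarith

theorem le_one_add_norm_sub (x z : S n) (r : ℝ) : r ≤ 1 + ‖(x : E n) - r • (z : E n)‖ := by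
  have hx : ‖(x : E n)‖ = 1 := by simp
  have hz : ‖(z : E n)‖ = 1 := by simp
  have := norm_sub_norm_le (r • (z : E n)) (x : E n)
  rw [hx, norm_smul, hz, mul_one, norm_sub_rev, Real.norm_eq_abs] at this
  linarith [le_abs_self r]

theorem norm_sub_le_two (x z : S n) : ‖(x : E n) - z‖ ≤ 2 := by
  have hx : ‖(x : E n)‖ = 1 := by simp
  have hz : ‖(z : E n)‖ = 1 := by simp
  have := norm_sub_le (x : E n) z
  linarith

theorem norm_sub_pos {x z : S n} (h : z ≠ x) : 0 < ‖(x : E n) - z‖ :=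
  norm_pos_iff.2 (sub_ne_zero.2 fun h' => h (Subtype.ext h'.symm))

/-- With m = |x - rz|, r ≤ 1 + m gives r^{n-1} ≤ 2^{n-2} (1 + m^{n-1}). Dividing by m^{n+1} leaves
m^{-(n+1)}, which governs the singularity, and m^{-2}, which governs the decay in r. -/
theorem omegaIntegrand_le (hn : 2 ≤ n) {x z : S n} (hxz : z ≠ x) {r : ℝ} (hr : 0 < r) :
    omegaIntegrand x z r ≤ 2 ^ (n - 1 - 1) * (3 ^ (n + 1) *
      ((‖(x : E n) - z‖ + |1 - r|) ^ (n + 1))⁻¹ + 3 ^ 2 * ((‖(x : E n) - z‖ + |1 - r|) ^ 2)⁻¹) := by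
  have hd := norm_sub_pos hxz
  have hm := dist_add_abs_le x z hr
  have hr1 := le_one_add_norm_sub x z r
  unfold omegaIntegrand
  set m := ‖(x : E n) - r • (z : E n)‖
  set D := ‖(x : E n) - z‖ + |1 - r| with hD
  have hDp : 0 < D := by positivity
  have hmp : 0 < m := by linarith
  have hinv : ∀ k : ℕ, (m ^ k)⁻¹ ≤ 3 ^ k * (D ^ k)⁻¹ := fun k => by
    rw [← div_eq_mul_inv, ← div_pow, ← inv_pow]
    gcongr
    rw [inv_eq_one_div, div_le_div_iff₀ hmp hDp]
    linarith
  obtain ⟨k, rfl⟩ : ∃ k, n = k + 1 := ⟨n - 1, by omega⟩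
  simp only [Nat.add_sub_cancel]
  calc r ^ k / m ^ (k + 1 + 1) ≤ (1 + m) ^ k / m ^ (k + 1 + 1) := by gcongr
    _ ≤ (2 ^ (k - 1) * (1 ^ k + m ^ k)) / m ^ (k + 1 + 1) := by
        gcongr
        exact add_pow_le zero_le_one hmp.le k
    _ = 2 ^ (k - 1) * ((m ^ (k + 1 + 1))⁻¹ + (m ^ 2)⁻¹) := by
        rw [one_pow]
        field_simp
        ring
    _ ≤ _ := by gcongr <;> exact hinv _

/-- A constant, depending only on `n`, in the bounds for the kernels. -/
noncomputable def kerConst (n : ℕ) : ℝ :=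
  2 ^ (n - 1 - 1) * (3 ^ (n + 1) * ∫ t : ℝ, ((1 + |t|) ^ (n + 1))⁻¹) +
    2 ^ (n - 1 - 1) * (3 ^ 2 * (2 ^ (n - 1) * ∫ t : ℝ, ((1 + |t|) ^ 2)⁻¹))

theorem kerConst_nonneg (n : ℕ) : 0 ≤ kerConst n := by
  have h : ∀ k : ℕ, 0 ≤ ∫ t : ℝ, ((1 + |t|) ^ k)⁻¹ := fun k =>
    integral_nonneg fun t => by positivity
  have := h (n + 1)
  have := h 2
  unfold kerConst
  positivity

theorem kernel_bound (hn : 2 ≤ n) {x z : S n} (hxz : z ≠ x) {A : ℝ} (hA : 0 ≤ A) {G : ℝ → ℝ}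
    (hG : Measurable G) (hGA : ∀ r, 0 < r → |G r| ≤ A * omegaIntegrand x z r) :
    IntegrableOn G (Ioi 0) ∧
      |∫ r in Ioi (0 : ℝ), G r| ≤ A * kerConst n / ‖(x : E n) - z‖ ^ n := by
  have hd := norm_sub_pos hxz
  have hd2 := norm_sub_le_two x z
  have hbd : ∀ r, 0 < r → |G r| ≤ A * _ := fun r hr =>
    (hGA r hr).trans (mul_le_mul_of_nonneg_left (omegaIntegrand_le hn hxz hr) hA)
  set d := ‖(x : E n) - z‖
  have i1 := (integrable_inv_add_abs_pow hd (k := n + 1) (by omega)).const_mul (3 ^ (n + 1))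
  have i2 := (integrable_inv_add_abs_pow hd (k := 2) le_rfl).const_mul (3 ^ 2)
  have i3 := ((i1.add i2).const_mul (2 ^ (n - 1 - 1))).const_mul A
  have hae : ∀ᵐ r ∂(volume.restrict (Ioi (0 : ℝ))), ‖G r‖ ≤ A * (2 ^ (n - 1 - 1) * (3 ^ (n + 1) *
      ((d + |1 - r|) ^ (n + 1))⁻¹ + 3 ^ 2 * ((d + |1 - r|) ^ 2)⁻¹)) := by
    filter_upwards [ae_restrict_mem measurableSet_Ioi] with r hr
    exact hbd r hr
  refine ⟨(i3.integrableOn (s := Ioi 0)).mono' hG.aestronglyMeasurable hae, ?_⟩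
  calc |∫ r in Ioi (0 : ℝ), G r| ≤ ∫ r in Ioi (0 : ℝ), A * (2 ^ (n - 1 - 1) * (3 ^ (n + 1) *
        ((d + |1 - r|) ^ (n + 1))⁻¹ + 3 ^ 2 * ((d + |1 - r|) ^ 2)⁻¹)) :=
        norm_integral_le_of_norm_le i3.integrableOn hae
    _ ≤ ∫ r : ℝ, A * (2 ^ (n - 1 - 1) * (3 ^ (n + 1) *
        ((d + |1 - r|) ^ (n + 1))⁻¹ + 3 ^ 2 * ((d + |1 - r|) ^ 2)⁻¹)) :=
        setIntegral_le_integral i3 (.of_forall fun r => by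
          simp only [Pi.zero_apply]; positivity)
    _ = A * (2 ^ (n - 1 - 1) * (3 ^ (n + 1) * ((d ^ (n + 1))⁻¹ * d *
          ∫ t : ℝ, ((1 + |t|) ^ (n + 1))⁻¹) +
          3 ^ 2 * ((d ^ 2)⁻¹ * d * ∫ t : ℝ, ((1 + |t|) ^ 2)⁻¹))) := by
        rw [integral_const_mul, integral_const_mul, integral_add i1 i2, integral_const_mul,
          integral_const_mul, integral_inv_add_abs_pow hd, integral_inv_add_abs_pow hd]
    _ ≤ A * (2 ^ (n - 1 - 1) * (3 ^ (n + 1) * ((d ^ n)⁻¹ *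
          ∫ t : ℝ, ((1 + |t|) ^ (n + 1))⁻¹) +
          3 ^ 2 * (2 ^ (n - 1) * (d ^ n)⁻¹ * ∫ t : ℝ, ((1 + |t|) ^ 2)⁻¹))) := by
        have e1 : (d ^ (n + 1))⁻¹ * d = (d ^ n)⁻¹ := by field_simp; ring
        -- The weaker singularity d^{-1} is absorbed into d^{-n} because d ≤ 2 on the sphere.
        have e2 : (d ^ 2)⁻¹ * d ≤ 2 ^ (n - 1) * (d ^ n)⁻¹ := by
          obtain ⟨k, rfl⟩ : ∃ k, n = k + 1 := ⟨n - 1, by omega⟩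
          rw [Nat.add_sub_cancel, show (d ^ 2)⁻¹ * d = d ^ k * (d ^ (k + 1))⁻¹ by field_simp; ring]
          gcongr
        have h : 0 ≤ ∫ t : ℝ, ((1 + |t|) ^ 2)⁻¹ := integral_nonneg fun t => by positivity
        rw [e1]
        gcongr
    _ = _ := by rw [kerConst, div_eq_mul_inv]; ring

theorem omegaIntegrand_nonneg (x z : S n) {r : ℝ} (hr : 0 < r) : 0 ≤ omegaIntegrand x z r := by
  unfold omegaIntegrand; positivity

theorem measurable_omegaIntegrand (x z : S n) : Measurable (omegaIntegrand x z) := by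
  unfold omegaIntegrand; fun_prop

theorem measurable_omegaHatIntegrand (x ξ z : S n) : Measurable (omegaHatIntegrand x ξ z) := by
  unfold omegaHatIntegrand; fun_prop

theorem omega_bound (hn : 2 ≤ n) {x z : S n} (hxz : z ≠ x) :
    IntegrableOn (omegaIntegrand x z) (Ioi 0) ∧
      |omega x z| ≤ kerConst n / ‖(x : E n) - z‖ ^ n := by
  have := kernel_bound hn hxz zero_le_one (measurable_omegaIntegrand x z) fun r hr => by
    rw [one_mul, abs_of_nonneg (omegaIntegrand_nonneg x z hr)]
  rwa [one_mul, ← abs_neg] at this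

theorem omegaHat_bound (hn : 2 ≤ n) {x ξ z : S n} (hξ : ⟪(x : E n), ξ⟫ = 0) (hxz : z ≠ x) :
    IntegrableOn (omegaHatIntegrand x ξ z) (Ioi 0) ∧
      |omegaHat x ξ z| ≤ 1 / area n * ((n + 2) * kerConst n) / ‖(x : E n) - z‖ ^ n := by
  have := kernel_bound hn hxz (A := n + 2) (by positivity)
    (measurable_omegaHatIntegrand x ξ z) fun r hr => by
    have hn1 : ‖(ξ : E n)‖ = 1 := by simp
    have hd := norm_sub_pos hxz
    have hm := dist_add_abs_le x z hr
    -- Orthogonality ξ ⊥ x is decisive: ⟨ξ, rz⟩ = -⟨ξ, x - rz⟩, so the numerator cancels two powers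
    -- of the denominator.
    have hi : ⟪(ξ : E n), r • (z : E n)⟫ ^ 2 ≤ ‖(x : E n) - r • (z : E n)‖ ^ 2 := by
      have h1 : ⟪(ξ : E n), r • (z : E n)⟫ = -⟪(ξ : E n), (x : E n) - r • (z : E n)⟫ := by
        rw [inner_sub_right, real_inner_comm (x : E n), hξ]; simp
      have h2 := abs_real_inner_le_norm (ξ : E n) ((x : E n) - r • (z : E n))
      rw [hn1, one_mul] at h2
      rw [h1, neg_sq]
      exact sq_le_sq' (abs_le.1 h2).1 (abs_le.1 h2).2
    unfold omegaHatIntegrand omegaIntegrand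
    set m := ‖(x : E n) - r • (z : E n)‖
    have hmp : 0 < m := by have := abs_nonneg (1 - r); linarith
    set p := ⟪(ξ : E n), r • (z : E n)⟫ ^ 2 with hp
    have hp0 : 0 ≤ p := sq_nonneg _
    have hnum : |m ^ 2 - (n + 1) * p| ≤ (n + 2) * m ^ 2 := by
      have : (0 : ℝ) ≤ n := n.cast_nonneg
      rw [abs_le]
      constructor <;> nlinarith
    rw [abs_mul, abs_div, abs_of_pos (pow_pos hmp (n + 3)), abs_of_pos (pow_pos hr _)]
    calc _ ≤ (n + 2) * m ^ 2 / m ^ (n + 3) * r ^ (n - 1) := by gcongr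
      _ = _ := by field_simp; ring
  refine ⟨this.1, ?_⟩
  have ha := area_pos n
  rw [omegaHat, abs_mul, abs_of_nonneg (by positivity), mul_div_assoc]
  gcongr
  exact this.2

/-! ### The kernels on the sphere as radial integrals of the kernels in space. -/

/-- As ξ ⊥ x, the factor ⟨rz - x, ξ⟩ is r⟨z, ξ⟩. The powers r^n from the volume, r from this factor
and r^{-2} from h combine to the r^{n-1} of ω. -/
theorem polar_gradKer (hn : 2 ≤ n) {x ξ : S n} (hξ : ⟪(x : E n), ξ⟫ = 0) (z : S n) {h : E n → ℝ}
    (hh : IsHom (-2) h) :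
    ∫ r in Ioi (0 : ℝ), r ^ n * (gradKer 0 (ξ : E n) (r • (z : E n) - x) * h (r • (z : E n))) =
      -(omega x z * ⟪(ξ : E n), z⟫ * h z) := by
  have : ∀ r ∈ Ioi (0 : ℝ),
      r ^ n * (gradKer 0 (ξ : E n) (r • (z : E n) - x) * h (r • (z : E n))) =
      omegaIntegrand x z r * (⟪(ξ : E n), z⟫ * h z) := fun r hr => by
    have hr0 : 0 < r := hr
    rw [gradKer, hh r _ hr0 (by simp [← norm_pos_iff]), inner_sub_left, hξ, sub_zero,
      real_inner_smul_left, invNorm_zero, norm_sub_rev, real_inner_comm, omegaIntegrand]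
    obtain ⟨k, rfl⟩ : ∃ k, n = k + 1 := ⟨n - 1, by omega⟩
    rw [zpow_neg, Nat.add_sub_cancel, inv_pow, div_eq_mul_inv,
      show r ^ (2 : ℤ) = r ^ 2 by norm_cast]
    field_simp
    ring
  rw [setIntegral_congr_fun measurableSet_Ioi this, integral_mul_const, omega]
  ring

theorem polar_hessKer (hn : 2 ≤ n) {x ξ : S n} (hξ : ⟪(x : E n), ξ⟫ = 0) (z : S n) {h : E n → ℝ}
    (hh : IsHom (-1) h) :
    ∫ r in Ioi (0 : ℝ),
      r ^ n * (hessKer 0 (ξ : E n) ξ (r • (z : E n) - x) * h (r • (z : E n))) =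
      area n * (omegaHat x ξ z * h z) := by
  have : ∀ r ∈ Ioi (0 : ℝ),
      r ^ n * (hessKer 0 (ξ : E n) ξ (r • (z : E n) - x) * h (r • (z : E n))) =
      omegaHatIntegrand x ξ z r * h z := fun r hr => by
    have hr0 : 0 < r := hr
    have hn1 : ‖(ξ : E n)‖ = 1 := by simp
    rw [hessKer, hh r _ hr0 (by simp [← norm_pos_iff]), inner_sub_left, hξ, sub_zero,
      invNorm_zero, norm_sub_rev, omegaHatIntegrand, real_inner_self_eq_norm_sq,
      hn1, real_inner_comm (ξ : E n), inv_pow, inv_pow]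
    obtain ⟨k, rfl⟩ : ∃ k, n = k + 1 := ⟨n - 1, by omega⟩
    rw [zpow_neg, Nat.add_sub_cancel, zpow_one]
    -- If x = rz, both sides vanish by the convention for division by zero.
    rcases eq_or_ne ‖(x : E (k + 1)) - r • (z : E (k + 1))‖ 0 with h0 | h0
    · simp [h0]
    · field_simp
      ring
  rw [setIntegral_congr_fun measurableSet_Ioi this, integral_mul_const, omegaHat]
  have := (area_pos n).ne'
  field_simp

/-! ### Homogeneous extensions and the geometry of the sphere. -/

theorem norm_coe (z : S n) : ‖(z : E n)‖ = 1 := by simp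

theorem coe_ne_zero (z : S n) : (z : E n) ≠ 0 := by simp [← norm_pos_iff]

/-- The radial projection onto the sphere. -/
noncomputable def proj {y : E n} (hy : y ≠ 0) : S n := ⟨‖y‖⁻¹ • y, normalize_mem hy⟩

theorem homExt_of_ne (k : ℤ) (f : S n → ℝ) {y : E n} (hy : y ≠ 0) :
    homExt k f y = ‖y‖ ^ k * f (proj hy) := dif_neg hy

theorem homExt_coe (k : ℤ) (f : S n → ℝ) (z : S n) : homExt k f z = f z := by
  rw [homExt_of_ne k f (coe_ne_zero z), norm_coe, one_zpow, one_mul]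
  congr 1
  ext1
  simp [proj]

theorem isHom_homExt (k : ℤ) (f : S n → ℝ) : IsHom k (homExt k f) := fun r y hr hy => by
  rw [homExt_of_ne k f hy, homExt_of_ne k f (smul_ne_zero hr.ne' hy), norm_smul,
    Real.norm_of_nonneg hr.le, mul_zpow, mul_assoc]
  congr 3
  ext1
  simp only [proj, norm_smul, Real.norm_of_nonneg hr.le, smul_smul]
  congr 1
  field_simp

theorem IsHom.eq_of_eq_on_sphere {k : ℤ} {g h : E n → ℝ} (hg : IsHom k g) (hh : IsHom k h)
    (hs : ∀ z : S n, g z = h z) {y : E n} (hy : y ≠ 0) : g y = h y := by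
  rw [hg.eq_norm_zpow_mul hy, hh.eq_norm_zpow_mul hy, hs ⟨_, normalize_mem hy⟩]

theorem homExt_one_eq (u : S n → ℝ) {y : E n} (hy : y ≠ 0) :
    homExt 1 u y = ‖y‖ * homExt 0 u y := by
  rw [homExt_of_ne 1 u hy, homExt_of_ne 0 u hy]; simp

theorem contDiffOn_homExt_one {u : S n → ℝ} (hu : IsC2 u) : ContDiffOn ℝ 2 (homExt 1 u) {0}ᶜ := by
  refine ContDiffOn.congr (f := fun y => ‖y‖ * homExt 0 u y) ?_ fun y hy => homExt_one_eq u hy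
  exact ContDiffOn.mul (fun y hy => (contDiffAt_norm ℝ hy).contDiffWithinAt) hu

theorem hasFDerivAt_norm {y : E n} (hy : y ≠ 0) :
    HasFDerivAt (fun y : E n => ‖y‖) (‖y‖⁻¹ • innerSL ℝ y) y := by
  have h0 : ‖y‖ ≠ 0 := norm_ne_zero_iff.2 hy
  have h := (hasStrictFDerivAt_norm_sq y).hasFDerivAt.sqrt (by positivity)
  simp only [Real.sqrt_sq (norm_nonneg _)] at h
  refine h.congr_fderiv ?_
  ext w
  simp
  field_simp

theorem fderiv_homExt_one {u : S n → ℝ} (hu : IsC2 u) (v : E n) {y : E n} (hy : y ≠ 0) :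
    fderiv ℝ (homExt 1 u) y v =
      ⟪y, v⟫ * ‖y‖⁻¹ * homExt 0 u y + ‖y‖ * fderiv ℝ (homExt 0 u) y v := by
  have hnear : homExt 1 u =ᶠ[𝓝 y] fun y => ‖y‖ * homExt 0 u y := by
    filter_upwards [isOpen_compl_zero.mem_nhds hy] with z hz using homExt_one_eq u hz
  have hd : DifferentiableAt ℝ (homExt 0 u) y :=
    (hu.contDiffAt (isOpen_compl_zero.mem_nhds hy)).differentiableAt (by simp)
  have h : HasFDerivAt (fun y => ‖y‖ * homExt 0 u y) _ y := (hasFDerivAt_norm hy).mul hd.hasFDerivAt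
  rw [hnear.fderiv_eq, h.fderiv]
  simp
  ring

/-- Product rule for |y| times the extension of degree 0. At a unit point x the gradient of |y| is x
and its Hessian is the projection onto the complement of x. All directions are kept, not only
tangent ones, because the trace is taken over an arbitrary orthonormal basis. -/
theorem hess_homExt_one {u : S n → ℝ} (hu : IsC2 u) (v w : E n) (x : S n) :
    hess (homExt 1 u) v w x = (⟪v, w⟫ - ⟪(x : E n), v⟫ * ⟪(x : E n), w⟫) * u x +
      ⟪(x : E n), v⟫ * fderiv ℝ (homExt 0 u) x w + ⟪(x : E n), w⟫ * fderiv ℝ (homExt 0 u) x v +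
      hess (homExt 0 u) v w x := by
  have hx := coe_ne_zero x
  have hnear : (fun y => fderiv ℝ (homExt 1 u) y v) =ᶠ[𝓝 (x : E n)]
      fun y => ⟪y, v⟫ * ‖y‖⁻¹ * homExt 0 u y + ‖y‖ * fderiv ℝ (homExt 0 u) y v := by
    filter_upwards [isOpen_compl_zero.mem_nhds hx] with z hz using fderiv_homExt_one hu v hz
  have hd : HasFDerivAt (homExt 0 u) _ (x : E n) :=
    ((hu.contDiffAt (isOpen_compl_zero.mem_nhds hx)).differentiableAt (by simp)).hasFDerivAt
  have hd2 : HasFDerivAt (fun y => fderiv ℝ (homExt 0 u) y v) _ (x : E n) :=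
    ((contDiffAt_fderiv_apply hu v hx).differentiableAt one_ne_zero).hasFDerivAt
  have hn := hasFDerivAt_norm hx
  have hni := (hasDerivAt_inv (norm_ne_zero_iff.2 hx)).comp_hasFDerivAt (x : E n) hn
  have h := (((hasFDerivAt_inner_left v (x : E n)).mul hni).mul hd).add (hn.mul hd2)
  have e := (h.congr_of_eventuallyEq (f₁ := fun y => fderiv ℝ (homExt 1 u) y v) hnear).fderiv
  rw [hess, e]
  simp [homExt_coe, hess]
  ring

theorem fderiv_homExt_zero_self {u : S n → ℝ} (hu : IsC2 u) (x : S n) :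
    fderiv ℝ (homExt 0 u) x (x : E n) = 0 := by
  have hx := coe_ne_zero x
  have hd : HasFDerivAt (homExt 0 u) (fderiv ℝ (homExt 0 u) x) ((1 : ℝ) • (x : E n)) := by
    rw [one_smul]
    exact ((hu.contDiffAt (isOpen_compl_zero.mem_nhds hx)).differentiableAt (by simp)).hasFDerivAt
  have h1 : HasDerivAt (fun t : ℝ => t • (x : E n)) (x : E n) 1 := by
    simpa using (hasDerivAt_id (1 : ℝ)).smul_const (x : E n)
  have h2 := hd.comp_hasDerivAt (1 : ℝ) h1
  have h3 : (homExt 0 u ∘ fun t : ℝ => t • (x : E n)) =ᶠ[𝓝 1] fun _ => homExt 0 u x := by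
    filter_upwards [lt_mem_nhds (zero_lt_one (α := ℝ))] with t ht
    simp [isHom_homExt 0 u t x ht hx]
  have h4 := h2.unique ((hasDerivAt_const (1 : ℝ) _).congr_of_eventuallyEq h3)
  simpa using h4

theorem iteratedFDeriv_eq_hess {U : E n → ℝ} (hU : ContDiffOn ℝ 2 U {0}ᶜ) (v w : E n) {y : E n}
    (hy : y ≠ 0) : iteratedFDeriv ℝ 2 U y ![v, w] = hess U v w y := by
  rw [iteratedFDeriv_two_apply, hess_comm hU v w hy, hess_eq hU w v hy]
  simp

theorem sphHessian_add_eq {u : S n → ℝ} (hu : IsC2 u) (x : S n) {ξ : E n}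
    (hξ : ⟪(x : E n), ξ⟫ = 0) :
    sphHessian u x ξ ξ + u x * ‖ξ‖ ^ 2 = hess (homExt 1 u) ξ ξ x := by
  rw [hess_homExt_one hu, hξ, sphHessian, iteratedFDeriv_eq_hess hu _ _ (coe_ne_zero x),
    real_inner_self_eq_norm_sq]
  ring

theorem hess_smul_smul {U : E n → ℝ} (hU : ContDiffOn ℝ 2 U {0}ᶜ) (c : ℝ) (v : E n) {y : E n}
    (hy : y ≠ 0) : hess U (c • v) (c • v) y = c ^ 2 * hess U v v y := by
  rw [hess_eq hU _ _ hy, hess_eq hU _ _ hy]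
  simp
  ring

/-- The form is quadratic in ξ, so unit tangent vectors suffice. -/
theorem isConvex_iff {u : S n → ℝ} (hu : IsC2 u) :
    IsConvex u ↔ ∀ x ξ : S n, ⟪(x : E n), ξ⟫ = 0 → 0 ≤ hess (homExt 1 u) (ξ : E n) ξ x := by
  constructor
  · intro h x ξ hξ
    rw [← sphHessian_add_eq hu x hξ]
    exact h x ξ hξ
  · intro h x ξ hξ
    rw [sphHessian_add_eq hu x hξ]
    rcases eq_or_ne ξ 0 with rfl | h0
    · have := hess_smul_smul (contDiffOn_homExt_one hu) 0 (0 : E n) (coe_ne_zero x)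
      rw [zero_smul] at this
      rw [this]
      simp
    · have := hess_smul_smul (contDiffOn_homExt_one hu) ‖ξ‖ (proj h0 : E n) (coe_ne_zero x)
      have e : ‖ξ‖ • (proj h0 : E n) = ξ := smul_inv_smul₀ (norm_ne_zero_iff.2 h0) ξ
      rw [e] at this
      rw [this]
      refine mul_nonneg (by positivity) (h x _ ?_)
      rw [proj, real_inner_smul_right, hξ, mul_zero]

/-- Both sides have degree -1, so it is enough to compare them on the sphere. There the trace of the
Hessian formula is n u + Δu; the mixed terms sum to the radial derivative of the degree 0 extension,
which is zero. -/
theorem sum_hess_homExt_one {f u : S n → ℝ} (hu : IsSolution f u)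
    (b : OrthonormalBasis (Fin (n + 1)) ℝ (E n)) {y : E n} (hy : y ≠ 0) :
    ∑ i, hess (homExt 1 u) (b i) (b i) y = homExt (-1) f y := by
  have hU := contDiffOn_homExt_one hu.1
  refine IsHom.eq_of_eq_on_sphere (k := -1) (g := fun y => ∑ i, hess (homExt 1 u) (b i) (b i) y)
    ?_ (isHom_homExt _ _) (fun x => ?_) hy
  · intro r y hr hy
    simp only [Finset.mul_sum]
    exact Finset.sum_congr rfl fun i _ =>
      (((isHom_homExt 1 u).fderiv_apply (b i)).fderiv_apply (b i)) r y hr hy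
  · have h1 : ∑ i, ⟪(x : E n), b i⟫ * ⟪(x : E n), b i⟫ = 1 := by
      have := b.sum_inner_mul_inner (x : E n) x
      simpa [real_inner_comm] using this
    have h2 : ∑ i, ⟪(x : E n), b i⟫ * fderiv ℝ (homExt 0 u) x (b i) = 0 := by
      have h := congrArg (fderiv ℝ (homExt 0 u) x) (b.sum_repr' (x : E n))
      rw [fderiv_homExt_zero_self hu.1 x, map_sum] at h
      simpa only [map_smul, smul_eq_mul, real_inner_comm] using h
    have h3 : sphLaplacian u x = ∑ i, hess (homExt 0 u) (b i) (b i) x := by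
      rw [sphLaplacian, InnerProductSpace.laplacian_eq_iteratedFDeriv_orthonormalBasis _ b]
      exact Finset.sum_congr rfl fun i _ => iteratedFDeriv_eq_hess hu.1 _ _ (coe_ne_zero x)
    rw [homExt_coe, ← hu.2 x, h3]
    simp only [hess_homExt_one hu.1, Finset.sum_add_distrib, h2, ← Finset.sum_mul,
      Finset.sum_sub_distrib, h1]
    simp
    ring

/-! ### Subtracting a constant from the solution. -/

theorem homExt_zero_sub_const (u : S n → ℝ) (c : ℝ) {y : E n} (hy : y ≠ 0) :
    homExt 0 (fun z => u z - c) y = homExt 0 u y - c := by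
  rw [homExt_of_ne 0 _ hy, homExt_of_ne 0 u hy]; simp

theorem IsC2.sub_const {u : S n → ℝ} (hu : IsC2 u) (c : ℝ) : IsC2 fun z => u z - c :=
  ContDiffOn.congr (f := fun y => homExt 0 u y - c) (ContDiffOn.sub hu contDiffOn_const)
    fun _ hy => homExt_zero_sub_const u c hy

theorem hess_homExt_zero_sub_const (u : S n → ℝ) (c : ℝ) (v w : E n) {y : E n} (hy : y ≠ 0) :
    hess (homExt 0 fun z => u z - c) v w y = hess (homExt 0 u) v w y := by
  have : (fun y => fderiv ℝ (homExt 0 fun z => u z - c) y v) =ᶠ[𝓝 y]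
      fun y => fderiv ℝ (homExt 0 u) y v := by
    filter_upwards [isOpen_compl_zero.mem_nhds hy] with t ht
    have : (homExt 0 fun z => u z - c) =ᶠ[𝓝 t] fun y => homExt 0 u y - c := by
      filter_upwards [isOpen_compl_zero.mem_nhds ht] with s hs using homExt_zero_sub_const u c hs
    rw [this.fderiv_eq, fderiv_sub_const]
  unfold hess
  rw [this.fderiv_eq]

theorem IsSolution.sub_const {f u : S n → ℝ} (hu : IsSolution f u) (c : ℝ) :
    IsSolution (fun z => f z - n * c) fun z => u z - c := by
  refine ⟨hu.1.sub_const c, fun x => ?_⟩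
  have : sphLaplacian (fun z => u z - c) x = sphLaplacian u x := by
    simp only [sphLaplacian, InnerProductSpace.laplacian_eq_iteratedFDeriv_orthonormalBasis _
      (EuclideanSpace.basisFun (Fin (n + 1)) ℝ)]
    refine Finset.sum_congr rfl fun i _ => ?_
    rw [iteratedFDeriv_eq_hess hu.1 _ _ (coe_ne_zero x),
      iteratedFDeriv_eq_hess (hu.1.sub_const c) _ _ (coe_ne_zero x),
      hess_homExt_zero_sub_const _ _ _ _ (coe_ne_zero x)]
  rw [this]
  simp only [← hu.2 x]
  ring

theorem hess_homExt_one_sub_const {u : S n → ℝ} (hu : IsC2 u) (c : ℝ) {x ξ : S n}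
    (hξ : ⟪(x : E n), ξ⟫ = 0) :
    hess (homExt 1 fun z => u z - c) (ξ : E n) ξ x = hess (homExt 1 u) (ξ : E n) ξ x - c := by
  rw [hess_homExt_one hu, hess_homExt_one (hu.sub_const c), hξ,
    hess_homExt_zero_sub_const _ _ _ _ (coe_ne_zero x), real_inner_self_eq_norm_sq, norm_coe]
  ring

/-! ### Regularity of the extension of Lipschitz data. -/

theorem norm_proj_sub_proj_le {y w : E n} (hy : y ≠ 0) (hw : w ≠ 0) :
    ‖(proj hy : E n) - proj hw‖ ≤ 2 * ‖y - w‖ / ‖y‖ := by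
  have hy' : 0 < ‖y‖ := norm_pos_iff.2 hy
  have hw' : 0 < ‖w‖ := norm_pos_iff.2 hw
  have e : (proj hy : E n) - proj hw = ‖y‖⁻¹ • ((y - w) + (‖w‖ - ‖y‖) • (‖w‖⁻¹ • w)) := by
    have : ‖w‖⁻¹ • w = (proj hw : E n) := rfl
    simp only [proj, smul_add, smul_sub, sub_smul, smul_inv_smul₀ hw'.ne']
    rw [inv_smul_smul₀ hy'.ne']
    abel
  have h1 : ‖(‖w‖ - ‖y‖) • (‖w‖⁻¹ • w)‖ ≤ ‖y - w‖ := by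
    rw [norm_smul, show ‖‖w‖⁻¹ • w‖ = 1 from norm_coe (proj hw), mul_one, Real.norm_eq_abs,
      norm_sub_rev]
    exact abs_norm_sub_norm_le w y
  rw [e, norm_smul, norm_inv, norm_norm, inv_mul_eq_div]
  gcongr
  linarith [norm_add_le (y - w) ((‖w‖ - ‖y‖) • (‖w‖⁻¹ • w))]

theorem exists_abs_le {f : S n → ℝ} (hf : Continuous f) : ∃ M, 0 ≤ M ∧ ∀ z, |f z| ≤ M := by
  obtain ⟨M, hM⟩ := isCompact_univ.exists_bound_of_continuousOn hf.continuousOn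
  exact ⟨|M|, abs_nonneg _, fun z => (hM z (mem_univ z)).trans (le_abs_self M)⟩

theorem continuousOn_homExt (k : ℤ) {f : S n → ℝ} (hf : Continuous f) :
    ContinuousOn (homExt k f) {0}ᶜ := by
  rw [continuousOn_iff_continuous_domRestrict]
  have : ({0}ᶜ : Set (E n)).domRestrict (homExt k f) =
      fun y : ({0}ᶜ : Set (E n)) => ‖(y : E n)‖ ^ k * f (proj y.2) := by
    ext y; exact homExt_of_ne k f y.2
  rw [this]
  have hne : ∀ y : ({0}ᶜ : Set (E n)), ‖(y : E n)‖ ≠ 0 := fun y => norm_ne_zero_iff.2 y.2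
  refine Continuous.mul ?_ (hf.comp ?_)
  · exact Continuous.zpow₀ (by fun_prop) k fun y => .inl (hne y)
  · exact Continuous.subtype_mk
      ((Continuous.inv₀ (by fun_prop) hne).smul continuous_subtype_val) _

theorem locallyLipschitzOn_homExt {f : S n → ℝ} {K : NNReal} (hf : LipschitzWith K f) :
    LocallyLipschitzOn {0}ᶜ (homExt (-1) f) := by
  obtain ⟨M, hM0, hM⟩ := exists_abs_le hf.continuous
  intro y0 hy0
  have h0 : 0 < ‖y0‖ := norm_pos_iff.2 hy0
  set a := ‖y0‖ / 2 with ha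
  have ha0 : 0 < a := by positivity
  have hL : 0 ≤ a⁻¹ * a⁻¹ * M + a⁻¹ * (K * (2 * a⁻¹)) := by positivity
  refine ⟨⟨_, hL⟩, {y | a < ‖y‖}, mem_nhdsWithin_of_mem_nhds
    ((isOpen_lt continuous_const continuous_norm).mem_nhds (by
      change a < ‖y0‖; linarith)), LipschitzOnWith.of_dist_le_mul fun y hy w hw => ?_⟩
  have hya : a < ‖y‖ := hy
  have hwa : a < ‖w‖ := hw
  have hyp : 0 < ‖y‖ := by linarith
  have hwp : 0 < ‖w‖ := by linarith
  have hy1 : y ≠ 0 := norm_pos_iff.1 hyp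
  have hw1 : w ≠ 0 := norm_pos_iff.1 hwp
  have iy : ‖y‖⁻¹ ≤ a⁻¹ := inv_anti₀ ha0 hya.le
  have iw : ‖w‖⁻¹ ≤ a⁻¹ := inv_anti₀ ha0 hwa.le
  rw [Real.dist_eq, dist_eq_norm, homExt_of_ne _ f hy1, homExt_of_ne _ f hw1, zpow_neg_one,
    zpow_neg_one]
  have e : ‖y‖⁻¹ * f (proj hy1) - ‖w‖⁻¹ * f (proj hw1) =
      (‖y‖⁻¹ * ‖w‖⁻¹ * (‖w‖ - ‖y‖)) * f (proj hy1) + ‖w‖⁻¹ * (f (proj hy1) - f (proj hw1)) := by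
    field_simp
    ring
  have h1 : |‖w‖ - ‖y‖| ≤ ‖y - w‖ := by
    rw [norm_sub_rev]; exact abs_norm_sub_norm_le w y
  have h2 : |f (proj hy1) - f (proj hw1)| ≤ K * (2 * a⁻¹ * ‖y - w‖) := by
    have := hf.dist_le_mul (proj hy1) (proj hw1)
    rw [Real.dist_eq, Subtype.dist_eq, dist_eq_norm] at this
    refine this.trans ?_
    gcongr
    refine (norm_proj_sub_proj_le hy1 hw1).trans ?_
    rw [div_eq_mul_inv]
    calc _ ≤ 2 * ‖y - w‖ * a⁻¹ := by gcongr
      _ = _ := by ring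
  rw [e]
  calc _ ≤ _ := abs_add_le _ _
    _ = ‖y‖⁻¹ * ‖w‖⁻¹ * |‖w‖ - ‖y‖| * |f (proj hy1)| + ‖w‖⁻¹ * |f (proj hy1) - f (proj hw1)| := by
        simp only [abs_mul, abs_inv, abs_norm]
    _ ≤ a⁻¹ * a⁻¹ * ‖y - w‖ * M + a⁻¹ * (K * (2 * a⁻¹ * ‖y - w‖)) := by
        gcongr
        exact hM _
    _ = (a⁻¹ * a⁻¹ * M + a⁻¹ * (K * (2 * a⁻¹))) * ‖y - w‖ := by ring

theorem LocallyLipschitzOn.exists_lipschitzOnWith_annulus {h : E n → ℝ}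
    (hh : LocallyLipschitzOn {0}ᶜ h) {a : ℝ} (ha : 0 < a) (b : ℝ) :
    ∃ K, LipschitzOnWith K h (Metric.closedBall 0 b \ Metric.ball 0 a) := by
  refine (hh.mono ?_).exists_lipschitzOnWith_of_compact
    ((isCompact_closedBall _ _).diff Metric.isOpen_ball)
  rintro y ⟨-, hy⟩ rfl
  exact hy (Metric.mem_ball_self ha)

theorem annulus_mem_nhds {a b : ℝ} {y : E n} (h1 : a < ‖y‖) (h2 : ‖y‖ < b) :
    Metric.closedBall 0 b \ Metric.ball 0 a ∈ 𝓝 y := by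
  filter_upwards [continuous_norm.continuousAt.eventually (lt_mem_nhds h1),
    continuous_norm.continuousAt.eventually (gt_mem_nhds h2)] with z hz1 hz2
  simpa using ⟨hz2.le, hz1.le⟩

/-- A Lipschitz constant on an annulus around the sphere bounds `fderiv` there, also where it takes
the default value 0; homogeneity extends the bound to all y ≠ 0. -/
theorem exists_fderiv_apply_bound {h : E n → ℝ} {k : ℤ} (hh : LocallyLipschitzOn {0}ᶜ h)
    (hom : IsHom k h) (v : E n) :
    ∃ C, 0 ≤ C ∧ ∀ y, y ≠ 0 → |fderiv ℝ h y v| ≤ C * ‖y‖ ^ (k - 1) := by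
  obtain ⟨K, hK⟩ := LocallyLipschitzOn.exists_lipschitzOnWith_annulus hh
    (show (0 : ℝ) < 1 / 2 by norm_num) 2
  refine ⟨K * ‖v‖, by positivity, fun y hy => ?_⟩
  rw [(hom.fderiv_apply v).eq_norm_zpow_mul hy, abs_mul,
    abs_of_nonneg (zpow_nonneg (norm_nonneg y) _), mul_comm]
  refine mul_le_mul_of_nonneg_right ?_ (zpow_nonneg (norm_nonneg y) _)
  have h1 : ‖‖y‖⁻¹ • y‖ = 1 := norm_coe (proj hy)
  refine ((fderiv ℝ h (‖y‖⁻¹ • y)).le_opNorm v).trans ?_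
  gcongr
  exact norm_fderiv_le_of_lipschitzOn ℝ (annulus_mem_nhds (by rw [h1]; norm_num)
    (by rw [h1]; norm_num)) hK

/-- Rademacher's theorem for a global Lipschitz extension from each of countably many annuli
exhausting the punctured space. -/
theorem ae_differentiableAt_of_locallyLipschitzOn {h : E n → ℝ}
    (hh : LocallyLipschitzOn {0}ᶜ h) : ∀ᵐ y : E n, DifferentiableAt ℝ h y := by
  have key : ∀ k : ℕ, ∀ᵐ y : E n, 1 / ((k : ℝ) + 1) < ‖y‖ → ‖y‖ < k + 1 →
      DifferentiableAt ℝ h y := fun k => by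
    obtain ⟨K, hK⟩ := LocallyLipschitzOn.exists_lipschitzOnWith_annulus hh
      (show (0 : ℝ) < 1 / ((k : ℝ) + 1) by positivity) (k + 1)
    obtain ⟨H, hHl, hHe⟩ := hK.extend_real
    filter_upwards [hHl.ae_differentiableAt] with y hy h1 h2
    refine hy.congr_of_eventuallyEq ?_
    filter_upwards [annulus_mem_nhds h1 h2] with z hz using hHe hz
  filter_upwards [ae_all_iff.2 key, ae_ne 0] with y hy h0
  have h0' : 0 < ‖y‖ := norm_pos_iff.2 h0
  obtain ⟨k1, hk1⟩ := exists_nat_one_div_lt h0'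
  obtain ⟨k2, hk2⟩ := exists_nat_gt ‖y‖
  refine hy (max k1 k2) (lt_of_le_of_lt ?_ hk1) (hk2.trans ?_)
  · gcongr
    exact le_max_left _ _
  · have : (k2 : ℝ) ≤ (max k1 k2 : ℕ) := by exact_mod_cast le_max_right k1 k2
    linarith

theorem IsHom.differentiableAt_of_smul {k : ℤ} {h : E n → ℝ} (hom : IsHom k h) {r : ℝ} {y : E n}
    (hr : 0 < r) (hy : y ≠ 0) (hd : DifferentiableAt ℝ h (r • y)) : DifferentiableAt ℝ h y := by
  have h1 : h =ᶠ[𝓝 y] fun z => (r ^ k)⁻¹ * h (r • z) := by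
    filter_upwards [isOpen_compl_zero.mem_nhds hy] with z hz
    rw [hom r z hr hz, inv_mul_cancel_left₀ (zpow_ne_zero _ hr.ne')]
  refine DifferentiableAt.congr_of_eventuallyEq ?_ h1
  exact (hd.comp y ((differentiable_id.const_smul r) y)).const_mul _

theorem ae_differentiableAt_homExt {f : S n → ℝ} {K : NNReal} (hf : LipschitzWith K f) :
    ∀ᵐ z : S n ∂(surf n), DifferentiableAt ℝ (homExt (-1) f) (z : E n) :=
  polar_ae (ae_differentiableAt_of_locallyLipschitzOn (locallyLipschitzOn_homExt hf))
    fun z _ hr => (isHom_homExt (-1) f).differentiableAt_of_smul hr (coe_ne_zero z)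

/-! ### The limit ε → 0: integral formulas for the Hessian. -/

theorem IsHom.neg_two {h : E n → ℝ} (hh : IsHom (-1) h) (v : E n) :
    IsHom (-2) fun y => fderiv ℝ h y v := hh.fderiv_apply v

theorem coe_sub_ne_zero {y a : E n} (h : y ≠ a) : y - a ≠ 0 := sub_ne_zero.2 h

theorem integral_approx_tendsto_hess (hn : 2 ≤ n) (x : S n) {U : E n → ℝ}
    (hU : ContDiffOn ℝ 2 U {0}ᶜ) (hom : IsHom 1 U) (ξ : E n) :
    Tendsto (fun ε => ∫ y, ((n + 1) * ε ^ 2 * invNorm ε (y - (x : E n)) ^ (n + 3)) * hess U ξ ξ y)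
      (𝓝[>] 0) (𝓝 (area n * hess U ξ ξ x)) := by
  obtain ⟨C, hC⟩ := exists_hess_bound hU hom ξ ξ
  exact tendsto_integral_approx hn x (measurable_fderiv_apply_const ℝ _ ξ) hC
    ((continuousOn_hess hU ξ ξ).continuousAt (isOpen_compl_zero.mem_nhds (coe_ne_zero x)))

theorem gradKer_mul_bound {x : S n} {ξ y : E n} {C p : ℝ} (ε : ℝ) (h0 : y ≠ 0) (hy : y ≠ x)
    (hp : |p| ≤ C * ‖y‖ ^ (-2 : ℤ)) :
    ‖gradKer ε ξ (y - (x : E n)) * p‖ ≤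
      ‖ξ‖ * C * (‖y‖ ^ (-2 : ℝ) * ‖y - (x : E n)‖ ^ (-(n : ℝ))) := by
  have h0' : 0 < ‖y‖ := norm_pos_iff.2 h0
  have hy' : 0 < ‖y - (x : E n)‖ := norm_pos_iff.2 (coe_sub_ne_zero hy)
  rw [norm_mul, Real.norm_eq_abs, Real.norm_eq_abs]
  calc _ ≤ (‖ξ‖ * (‖y - (x : E n)‖⁻¹) ^ n) * (C * ‖y‖ ^ (-2 : ℤ)) := by
        refine mul_le_mul ((abs_gradKer_le _ _).trans ?_) hp (abs_nonneg _) (by positivity)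
        gcongr
        · exact invNorm_nonneg _
        · exact invNorm_le_inv_norm (coe_sub_ne_zero hy)
    _ = _ := by
        rw [Real.rpow_neg h0'.le, Real.rpow_neg hy'.le, Real.rpow_natCast, zpow_neg, inv_pow,
          Real.rpow_ofNat, zpow_ofNat]
        ring

/-- The representation of the Hessian for a locally Lipschitz right-hand side. -/
theorem hess_eq_integral_gradKer (hn : 2 ≤ n) {x ξ : S n} {U F : E n → ℝ}
    (hU : ContDiffOn ℝ 2 U {0}ᶜ) (hom : IsHom 1 U)
    (b : OrthonormalBasis (Fin (n + 1)) ℝ (E n))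
    (hF : ∀ y, y ≠ 0 → ∑ i, hess U (b i) (b i) y = F y) (hFl : LocallyLipschitzOn {0}ᶜ F)
    (hFh : IsHom (-1) F) :
    area n * hess U (ξ : E n) ξ x =
      -∫ y, gradKer 0 (ξ : E n) (y - (x : E n)) * fderiv ℝ F y ξ := by
  obtain ⟨C1, -, h1⟩ := hFh.exists_bound hFl.continuousOn
  obtain ⟨C2, h20, h2⟩ := exists_fderiv_apply_bound hFl hFh (ξ : E n)
  refine tendsto_nhds_unique (integral_approx_tendsto_hess hn x hU hom ξ) ?_
  have lim : Tendsto (fun ε : ℝ => ∫ y, gradKer ε (ξ : E n) (y - (x : E n)) * fderiv ℝ F y ξ)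
      (𝓝[>] 0) (𝓝 (∫ y, gradKer 0 (ξ : E n) (y - (x : E n)) * fderiv ℝ F y ξ)) := by
    refine tendsto_integral_filter_of_dominated_convergence _
      (.of_forall fun ε => (Measurable.aestronglyMeasurable (by fun_prop)).mul
        (measurable_fderiv_apply_const ℝ F (ξ : E n)).aestronglyMeasurable)
      (.of_forall fun ε => ?_)
      ((integrable_norm_rpow_mul_sub x (a := 2) (b := n) (by norm_num) (by positivity)
        (by exact_mod_cast (by omega : 2 < n + 1)) (by linarith) (by linarith)).const_mul
          (‖(ξ : E n)‖ * C2)) ?_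
    · filter_upwards [ae_ne 0, ae_ne (x : E n)] with y h0 hy
      exact gradKer_mul_bound ε h0 hy (h2 y h0)
    · filter_upwards [ae_ne (x : E n)] with y hy
      exact ((tendsto_gradKer _ (coe_sub_ne_zero hy)).mono_left nhdsWithin_le_nhds).mul_const _
  refine lim.neg.congr' ?_
  filter_upwards [self_mem_nhdsWithin] with ε hε
  rw [integral_approx_mul_hess hn hε x hU hom ξ b hF]
  -- The extra integration by parts that the Lipschitz hypothesis affords: it trades the borderline
  -- singularity of order n + 1 at x for one of order n.
  refine (integral_gradKer_mul_fderiv hn hε x ξ ξ hFl (C := C1) (C' := C2) ?_ ?_).symm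
  · simpa using h1
  · intro y hy
    have := h2 y hy
    rwa [show ((-1 : ℤ) - 1) = -2 by norm_num, zpow_neg, zpow_ofNat] at this

theorem integrable_gradKer_mul (hn : 2 ≤ n) (x : S n) (ξ : E n) {F : E n → ℝ}
    (hFl : LocallyLipschitzOn {0}ᶜ F) (hFh : IsHom (-1) F) :
    Integrable fun y => gradKer 0 ξ (y - (x : E n)) * fderiv ℝ F y ξ := by
  obtain ⟨C2, h20, h2⟩ := exists_fderiv_apply_bound hFl hFh ξ
  refine ((integrable_norm_rpow_mul_sub x (a := 2) (b := n) (by norm_num) (by positivity)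
        (by exact_mod_cast (by omega : 2 < n + 1)) (by linarith) (by linarith)).const_mul
          (‖ξ‖ * C2)).mono' ((Measurable.aestronglyMeasurable (by fun_prop)).mul
        (measurable_fderiv_apply_const ℝ F ξ).aestronglyMeasurable) ?_
  filter_upwards [ae_ne 0, ae_ne (x : E n)] with y h0 hy
  exact gradKer_mul_bound 0 h0 hy (h2 y h0)

theorem hessKer_mul_bound {x : S n} {ξ : S n} {y : E n} {C p α : ℝ} (ε : ℝ) (h0 : y ≠ 0)
    (hy : y ≠ x) (hp : |p| ≤ C * ‖y - (x : E n)‖ ^ α * ‖y‖⁻¹) :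
    ‖hessKer ε (ξ : E n) ξ (y - (x : E n)) * p‖ ≤
      (n + 2) * C * (‖y‖ ^ (-1 : ℝ) * ‖y - (x : E n)‖ ^ (-((n : ℝ) + 1 - α))) := by
  have h0' : 0 < ‖y‖ := norm_pos_iff.2 h0
  have hy' : 0 < ‖y - (x : E n)‖ := norm_pos_iff.2 (coe_sub_ne_zero hy)
  rw [norm_mul, Real.norm_eq_abs, Real.norm_eq_abs]
  calc _ ≤ ((n + 2) * (‖y - (x : E n)‖⁻¹) ^ (n + 1)) * (C * ‖y - (x : E n)‖ ^ α * ‖y‖⁻¹) := by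
        refine mul_le_mul ((abs_hessKer_le _ _ _).trans ?_) hp (abs_nonneg _) (by positivity)
        rw [norm_coe, mul_one, mul_one]
        gcongr
        · exact invNorm_nonneg _
        · exact invNorm_le_inv_norm (coe_sub_ne_zero hy)
    _ = _ := by
        rw [Real.rpow_neg_one, neg_sub, Real.rpow_sub hy', inv_pow,
          show (n : ℝ) + 1 = ((n + 1 : ℕ) : ℝ) by push_cast; rfl, Real.rpow_natCast]
        ring

/-- The factor |y - x|^α lowers the order at x to n + 1 - α, integrable as α > 0. At infinity the
total order is n + 2 - α, which exceeds n + 1 as α < 1. -/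
theorem integrable_hessKer_mul {x ξ : S n} {F : E n → ℝ} {C α : ℝ} (hα : 0 < α)
    (hα1 : α < 1) (hn : 2 ≤ n) (hFm : AEStronglyMeasurable F volume)
    (hFb : ∀ y, y ≠ 0 → |F y| ≤ C * ‖y - (x : E n)‖ ^ α * ‖y‖⁻¹) :
    Integrable (fun y : E n => (n + 2) * C *
      (‖y‖ ^ (-1 : ℝ) * ‖y - (x : E n)‖ ^ (-((n : ℝ) + 1 - α)))) ∧
    Integrable fun y => hessKer 0 (ξ : E n) ξ (y - (x : E n)) * F y := by
  have hn' : (2 : ℝ) ≤ n := by exact_mod_cast hn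
  have hi := (integrable_norm_rpow_mul_sub x (a := 1) (b := (n : ℝ) + 1 - α) (by norm_num)
    (by linarith) (by linarith) (by linarith) (by linarith)).const_mul (((n : ℝ) + 2) * C)
  refine ⟨hi, hi.mono' ((Measurable.aestronglyMeasurable (by fun_prop)).mul hFm) ?_⟩
  filter_upwards [ae_ne 0, ae_ne (x : E n)] with y h0 hy
  exact hessKer_mul_bound 0 h0 hy (hFb y h0)

/-- The representation of the Hessian for a right-hand side that is Hölder continuous and vanishes
at the point `x`. -/
theorem hess_eq_integral_hessKer (hn : 2 ≤ n) {x ξ : S n} {U F : E n → ℝ}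
    (hU : ContDiffOn ℝ 2 U {0}ᶜ) (hom : IsHom 1 U)
    (b : OrthonormalBasis (Fin (n + 1)) ℝ (E n))
    (hF : ∀ y, y ≠ 0 → ∑ i, hess U (b i) (b i) y = F y) (hFm : AEStronglyMeasurable F volume)
    {C α : ℝ} (hα : 0 < α) (hα1 : α < 1)
    (hFb : ∀ y, y ≠ 0 → |F y| ≤ C * ‖y - (x : E n)‖ ^ α * ‖y‖⁻¹) :
    area n * hess U (ξ : E n) ξ x = ∫ y, hessKer 0 (ξ : E n) ξ (y - (x : E n)) * F y := by
  refine tendsto_nhds_unique (integral_approx_tendsto_hess hn x hU hom ξ) ?_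
  have lim : Tendsto (fun ε : ℝ => ∫ y, hessKer ε (ξ : E n) ξ (y - (x : E n)) * F y)
      (𝓝[>] 0) (𝓝 (∫ y, hessKer 0 (ξ : E n) ξ (y - (x : E n)) * F y)) := by
    refine tendsto_integral_filter_of_dominated_convergence _
      (.of_forall fun ε => (Measurable.aestronglyMeasurable (by fun_prop)).mul hFm)
      (.of_forall fun ε => ?_) (integrable_hessKer_mul (ξ := ξ) hα hα1 hn hFm hFb).1 ?_
    · filter_upwards [ae_ne 0, ae_ne (x : E n)] with y h0 hy
      exact hessKer_mul_bound ε h0 hy (hFb y h0)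
    · filter_upwards [ae_ne (x : E n)] with y hy
      exact ((tendsto_hessKer _ _ (coe_sub_ne_zero hy)).mono_left nhdsWithin_le_nhds).mul_const _
  refine lim.congr' ?_
  filter_upwards [self_mem_nhdsWithin] with ε hε
  exact (integral_approx_mul_hess hn hε x hU hom ξ b hF).symm

/-! ### Lipschitz data. -/

section Lipschitz

variable {f u : S n → ℝ} {K : NNReal} {x ξ : S n}

theorem polar_lipIntegrand (hn : 2 ≤ n) (f : S n → ℝ) (hξ : ⟪(x : E n), ξ⟫ = 0) (z : S n) :
    ∫ r in Ioi (0 : ℝ), r ^ n * (gradKer 0 (ξ : E n) (r • (z : E n) - x) *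
      fderiv ℝ (homExt (-1) f) (r • (z : E n)) ξ) = -lipIntegrand f x ξ z :=
  polar_gradKer hn hξ z ((isHom_homExt (-1) f).neg_two (ξ : E n))

theorem integrable_lipIntegrand (hn : 2 ≤ n) (hf : LipschitzWith K f)
    (hξ : ⟪(x : E n), ξ⟫ = 0) : Integrable (lipIntegrand f x ξ) (surf n) := by
  have h := (polar_integral (integrable_gradKer_mul hn x (ξ : E n) (locallyLipschitzOn_homExt hf)
    (isHom_homExt _ _))).1
  simp only [polar_lipIntegrand hn f hξ] at h
  exact integrable_neg_iff.1 h

theorem hess_eq_integral_lipIntegrand (hn : 2 ≤ n) (hf : LipschitzWith K f)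
    (hu : IsSolution f u) (hξ : ⟪(x : E n), ξ⟫ = 0) :
    area n * hess (homExt 1 u) (ξ : E n) ξ x = ∫ z, lipIntegrand f x ξ z ∂(surf n) := by
  have h := (polar_integral (integrable_gradKer_mul hn x (ξ : E n) (locallyLipschitzOn_homExt hf)
    (isHom_homExt _ _))).2
  simp only [polar_lipIntegrand hn f hξ] at h
  rw [hess_eq_integral_gradKer hn (contDiffOn_homExt_one hu.1) (isHom_homExt 1 u)
    (EuclideanSpace.basisFun (Fin (n + 1)) ℝ) (fun y hy => sum_hess_homExt_one hu _ hy)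
    (locallyLipschitzOn_homExt hf) (isHom_homExt _ _), h, integral_neg, neg_neg]

end Lipschitz

/-! ### Hölder data. -/

section Holder

variable {f u : S n → ℝ} {K α : NNReal} {x ξ : S n}

/-- The factor 2^α appears because the radial projection of y lies within 2|y - x| of x. -/
theorem abs_homExt_sub_le (hf : HolderWith K α f) (x : S n) {y : E n} (hy : y ≠ 0) :
    |homExt (-1) (fun z => f z - f x) y| ≤
      K * 2 ^ (α : ℝ) * ‖y - (x : E n)‖ ^ (α : ℝ) * ‖y‖⁻¹ := by
  rw [homExt_of_ne _ _ hy, abs_mul, zpow_neg_one, abs_inv, abs_norm, mul_comm]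
  gcongr
  have h1 := hf.dist_le (proj hy) x
  rw [Real.dist_eq, Subtype.dist_eq, dist_eq_norm] at h1
  refine h1.trans ?_
  rw [mul_assoc, ← Real.mul_rpow (by norm_num) (norm_nonneg _)]
  gcongr
  have e : proj (coe_ne_zero x) = x := by ext1; simp [proj]
  have := norm_proj_sub_proj_le (coe_ne_zero x) hy
  rwa [e, norm_coe, div_one, norm_sub_rev, norm_sub_rev (x : E n)] at this

theorem polar_omegaHat (hn : 2 ≤ n) (f : S n → ℝ) (hξ : ⟪(x : E n), ξ⟫ = 0) (z : S n) :
    ∫ r in Ioi (0 : ℝ), r ^ n * (hessKer 0 (ξ : E n) ξ (r • (z : E n) - x) *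
      homExt (-1) (fun z => f z - f x) (r • (z : E n))) =
      area n * (omegaHat x ξ z * (f z - f x)) := by
  rw [polar_hessKer hn hξ z (isHom_homExt _ _), homExt_coe]

theorem integrable_hessKer_mul_homExt (hn : 2 ≤ n) (hα : 0 < α) (hα1 : α < 1)
    (hf : HolderWith K α f) (x ξ : S n) :
    Integrable fun y => hessKer 0 (ξ : E n) ξ (y - (x : E n)) *
      homExt (-1) (fun z => f z - f x) y :=
  (integrable_hessKer_mul (NNReal.coe_pos.2 hα) (by exact_mod_cast hα1) hn
    (aestronglyMeasurable_of_continuousOn (continuousOn_homExt _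
      ((hf.continuous hα).sub continuous_const))) fun _ hy => abs_homExt_sub_le hf x hy).2

theorem integrable_omegaHat_mul (hn : 2 ≤ n) (hα : 0 < α) (hα1 : α < 1) (hf : HolderWith K α f)
    (hξ : ⟪(x : E n), ξ⟫ = 0) :
    Integrable (fun z => omegaHat x ξ z * (f z - f x)) (surf n) := by
  have h := (polar_integral (integrable_hessKer_mul_homExt hn hα hα1 hf x ξ)).1
  simp only [polar_omegaHat hn f hξ] at h
  exact (integrable_const_mul_iff (area_pos n).ne'.isUnit _).1 h

theorem hess_eq_integral_omegaHat (hn : 2 ≤ n) (hα : 0 < α) (hα1 : α < 1) (hf : HolderWith K α f)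
    (hu : IsSolution f u) (hξ : ⟪(x : E n), ξ⟫ = 0) :
    hess (homExt 1 u) (ξ : E n) ξ x =
      (∫ z, omegaHat x ξ z * (f z - f x) ∂(surf n)) + 1 / (n : ℝ) * f x := by
  have hn0 : (n : ℝ) ≠ 0 := by positivity
  have h := (polar_integral (integrable_hessKer_mul_homExt hn hα hα1 hf x ξ)).2
  simp only [polar_omegaHat hn f hξ] at h
  rw [integral_const_mul] at h
  set c := 1 / (n : ℝ) * f x with hc
  -- The constant c = f(x)/n is chosen so that the new right-hand side f - f(x) vanishes at x. It
  -- lowers the Hessian in a unit tangent direction by exactly c, which is added back at the end.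
  have hu' : IsSolution (fun z => f z - f x) fun z => u z - c := by
    have := hu.sub_const c
    rwa [show n * c = f x by rw [hc]; field_simp] at this
  have h2 := hess_eq_integral_hessKer hn (contDiffOn_homExt_one hu'.1) (isHom_homExt 1 _)
    (EuclideanSpace.basisFun (Fin (n + 1)) ℝ) (fun y hy => sum_hess_homExt_one hu' _ hy)
    (aestronglyMeasurable_of_continuousOn (continuousOn_homExt _
      ((hf.continuous hα).sub continuous_const))) (NNReal.coe_pos.2 hα) (by exact_mod_cast hα1)
    (fun _ hy => abs_homExt_sub_le hf x hy) (x := x) (ξ := ξ)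
  rw [h] at h2
  have h3 := mul_left_cancel₀ (area_pos n).ne' h2
  rw [hess_homExt_one_sub_const hu.1 c hξ] at h3
  linarith

end Holder

end Christoffel

/-! ### The theorem. -/

theorem theorem3 (n : ℕ) (hn : 2 ≤ n) :
    -- the kernel `ω` is well defined off the diagonal and is `O(|x - z|^{-n})` near it
    ((∀ x z : Christoffel.S n, z ≠ x →
        IntegrableOn (Christoffel.omegaIntegrand x z) (Ioi 0)) ∧
      ∃ C > 0, ∃ δ > 0, ∀ x z : Christoffel.S n, z ≠ x → ‖(x : Christoffel.E n) - z‖ < δ →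
        |Christoffel.omega x z| ≤ C / ‖(x : Christoffel.E n) - z‖ ^ n) ∧
    -- the same for the kernel `ω̂`
    ((∀ x ξ z : Christoffel.S n, ⟪(x : Christoffel.E n), ξ⟫ = 0 → z ≠ x →
        IntegrableOn (Christoffel.omegaHatIntegrand x ξ z) (Ioi 0)) ∧
      ∃ C > 0, ∃ δ > 0, ∀ x ξ z : Christoffel.S n, ⟪(x : Christoffel.E n), ξ⟫ = 0 → z ≠ x →
        ‖(x : Christoffel.E n) - z‖ < δ →
          |Christoffel.omegaHat x ξ z| ≤ C / ‖(x : Christoffel.E n) - z‖ ^ n) ∧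
    ∀ f : Christoffel.S n → ℝ, (∀ z, 0 < f z) →
      -- (i) Lipschitz continuous `f`
      ((∃ K : NNReal, LipschitzWith K f) →
        (∀ᵐ z : Christoffel.S n ∂(Christoffel.surf n),
          DifferentiableAt ℝ (Christoffel.homExt (-1) f) (z : Christoffel.E n)) ∧
        (∀ x ξ : Christoffel.S n, ⟪(x : Christoffel.E n), ξ⟫ = 0 →
          Integrable (Christoffel.lipIntegrand f x ξ) (Christoffel.surf n)) ∧
        ∀ u : Christoffel.S n → ℝ, Christoffel.IsSolution f u →
          (Christoffel.IsConvex u ↔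
            ∀ x ξ : Christoffel.S n, ⟪(x : Christoffel.E n), ξ⟫ = 0 →
              0 ≤ ∫ z, Christoffel.lipIntegrand f x ξ z ∂(Christoffel.surf n))) ∧
      -- (ii) Hölder continuous `f`
      (∀ α : NNReal, 0 < α → α < 1 → (∃ K : NNReal, HolderWith K α f) →
        (∀ x ξ : Christoffel.S n, ⟪(x : Christoffel.E n), ξ⟫ = 0 →
          Integrable (fun z => Christoffel.omegaHat x ξ z * (f z - f x))
            (Christoffel.surf n)) ∧
        ∀ u : Christoffel.S n → ℝ, Christoffel.IsSolution f u →
          (Christoffel.IsConvex u ↔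
            ∀ x ξ : Christoffel.S n, ⟪(x : Christoffel.E n), ξ⟫ = 0 →
              0 ≤ (∫ z, Christoffel.omegaHat x ξ z * (f z - f x) ∂(Christoffel.surf n)) +
                1 / (n : ℝ) * f x)) := by
  have hk := Christoffel.kerConst_nonneg n
  have ha := Christoffel.area_pos n
  -- The kernel bounds hold on the whole sphere off the diagonal, so δ = 1 is an arbitrary choice;
  -- the added 1 makes the constants strictly positive.
  refine ⟨⟨fun x z h => (Christoffel.omega_bound hn h).1, Christoffel.kerConst n + 1,
    by positivity, 1, one_pos, fun x z h _ => (Christoffel.omega_bound hn h).2.trans ?_⟩,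
    ⟨fun x ξ z hξ h => (Christoffel.omegaHat_bound hn hξ h).1,
      1 / Christoffel.area n * ((n + 2) * Christoffel.kerConst n) + 1, by positivity, 1, one_pos,
      fun x ξ z hξ h _ => (Christoffel.omegaHat_bound hn hξ h).2.trans ?_⟩, ?_⟩
  · gcongr
    linarith
  · gcongr
    linarith
  intro f _
  refine ⟨fun ⟨K, hf⟩ => ⟨Christoffel.ae_differentiableAt_homExt hf,
    fun x ξ hξ => Christoffel.integrable_lipIntegrand hn hf hξ, fun u hu => ?_⟩,
    fun α hα hα1 ⟨K, hf⟩ => ⟨fun x ξ hξ =>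
      Christoffel.integrable_omegaHat_mul hn hα hα1 hf hξ, fun u hu => ?_⟩⟩
  · rw [Christoffel.isConvex_iff hu.1]
    refine forall₃_congr fun x ξ hξ => ?_
    rw [← Christoffel.hess_eq_integral_lipIntegrand hn hf hu hξ]
    -- The integral is ω_n times the Hessian, and the positive factor does not affect the sign.
    exact (mul_nonneg_iff_of_pos_left ha).symm
  · rw [Christoffel.isConvex_iff hu.1]
    refine forall₃_congr fun x ξ hξ => ?_
    rw [Christoffel.hess_eq_integral_omegaHat hn hα hα1 hf hu hξ]
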